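/- For an integer $n$ and a real number $\theta$ let $\widetilde{\mathcal M}_n(\theta)$ be the set of all $n$-tuples $P=(P_0,\dots,P_{n-1})$ of points of $\mathbb R^3$ (indices modulo $n$) such that $|P_i-P_{i+1}|=1$ and $\angle P_{i-1}P_iP_{i+1}=\theta$ for every $i$, where $\angle$ is the unoriented angle in $[0,\pi]$; edges may intersect and vertices may coincide. Give it the subspace topology from $(\mathbb R^3)^n$, and let $\mathcal M_n(\theta)=\widetilde{\mathcal M}_n(\theta)/G$ with the quotient topology, where $G$ is the group of orientation preserving isometries of $\mathbb R^3$, acting on all vertices simultaneously. A hexagon $P$ is called a boat (respectively a chair) if for some index $i$ one has $\overrightarrow{P_{i-1}P_{i-2}}=\overrightarrow{P_{i+1}P_{i+2}}$ and the two remaining vertices $P_i$ and $P_{i+3}$ lie strictly on the same side (respectively strictly on opposite sides) of the plane spanned by $P_{i-2},P_{i-1},P_{i+1},P_{i+2}$. Let $\theta\in\mathbb R$, $\theta\neq\frac{\pi}{3}$. 1. If $\theta=0$ or $\theta=\frac{2\pi}{3}$, then $\mathcal M_6(\theta)$ is homeomorphic to a point. 2. If $\frac{\pi}{3}<\theta<\frac{2\pi}{3}$,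 then $\mathcal M_6(\theta)$ is homeomorphic to the disjoint union of a circle and two isolated points. 3. If $0<\theta<\frac{\pi}{3}$, then $\mathcal M_6(\theta)$ is homeomorphic to the disjoint union of two circles and four isolated points. 4. If $\theta<0$ or $\theta>\frac{2\pi}{3}$, then $\mathcal M_6(\theta)$ is empty. Moreover, in cases 2 and 3 the homeomorphism sends the class of every boat into the union of the circles and the class of every chair to one of the isolated points. -/

import Mathlib

open scoped EuclideanGeometry

/-- Euclidean three-space. -/
abbrev E3 : Type := EuclideanSpace ℝ (Fin 3)

/-- The group of orientation preserving isometries of `ℝ³`. -/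
def orientationPreserving : Subgroup (E3 ≃ᵃⁱ[ℝ] E3) where
  carrier := {g | 0 < LinearMap.det (g.linearIsometryEquiv.toLinearEquiv : E3 →ₗ[ℝ] E3)}
  one_mem' := by
    change 0 < LinearMap.det (LinearMap.id : E3 →ₗ[ℝ] E3)
    simp
  mul_mem' := by
    intro g h hg hh
    have e : ((g * h).linearIsometryEquiv.toLinearEquiv : E3 →ₗ[ℝ] E3) =
        (g.linearIsometryEquiv.toLinearEquiv : E3 →ₗ[ℝ] E3) ∘ₗ
          (h.linearIsometryEquiv.toLinearEquiv : E3 →ₗ[ℝ] E3) := rfl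
    simp only [Set.mem_ofPred_eq] at *
    rw [e, LinearMap.det_comp]
    exact mul_pos hg hh
  inv_mem' := by
    intro g hg
    have e : ((g⁻¹).linearIsometryEquiv.toLinearEquiv : E3 →ₗ[ℝ] E3) =
        (g.linearIsometryEquiv.toLinearEquiv.symm : E3 →ₗ[ℝ] E3) := rfl
    simp only [Set.mem_ofPred_eq] at *
    rw [e, LinearEquiv.det_coe_symm]
    exact inv_pos.mpr hg

/-- The space of `θ`-equiangular unit equilateral `n`-gons `(P_0, …, P_{n-1})` in `ℝ³`, with
indices modulo `n`; edges may intersect and vertices may overlap. -/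
def Polygons (n : ℕ) (θ : ℝ) : Set (ZMod n → E3) :=
  {P | ∀ i, dist (P i) (P (i + 1)) = 1 ∧ ∠ (P (i - 1)) (P i) (P (i + 1)) = θ}

/-- Two polygons are equivalent if an orientation preserving isometry of `ℝ³` carries each vertex
of the first to the vertex of the second with the same label. -/
def polygonSetoid (n : ℕ) (θ : ℝ) : Setoid (Polygons n θ) where
  r P Q := ∃ g ∈ orientationPreserving, ∀ i, g (P.1 i) = Q.1 i
  iseqv :=
    { refl := fun _ => ⟨1, orientationPreserving.one_mem, fun _ => rfl⟩
      symm := by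
        rintro P Q ⟨g, hg, h⟩
        refine ⟨g⁻¹, orientationPreserving.inv_mem hg, fun i => ?_⟩
        rw [← h i]
        exact g.symm_apply_apply (P.1 i)
      trans := by
        rintro P Q R ⟨g, hg, h⟩ ⟨k, hk, h'⟩
        refine ⟨k * g, orientationPreserving.mul_mem hk hg, fun i => ?_⟩
        rw [← h' i, ← h i]
        rfl }

/-- The configuration space of `θ`-equiangular unit equilateral `n`-gons: polygons modulo
orientation preserving isometries, with the quotient topology. -/
def ConfigSpace (n : ℕ) (θ : ℝ) : Type := Quotient (polygonSetoid n θ)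

instance (n : ℕ) (θ : ℝ) : TopologicalSpace (ConfigSpace n θ) :=
  inferInstanceAs (TopologicalSpace (Quotient (polygonSetoid n θ)))

/-- The class `[P]` of a polygon in the configuration space. -/
def ConfigSpace.mk {n : ℕ} {θ : ℝ} (P : Polygons n θ) : ConfigSpace n θ :=
  Quotient.mk (polygonSetoid n θ) P

/-- The edges `P_{i-1}P_{i-2}` and `P_{i+1}P_{i+2}` of a hexagon agree as vectors, so that
`P_{i-1}, P_{i+1}, P_{i+2}, P_{i-2}` are the consecutive corners of a parallelogram. -/
def IsSeat (P : ZMod 6 → E3) (i : ZMod 6) : Prop :=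
  P (i - 2) - P (i - 1) = P (i + 2) - P (i + 1)

/-- The affine span of the four vertices of a hexagon other than `P_i` and `P_{i+3}`. -/
noncomputable def seatPlane (P : ZMod 6 → E3) (i : ZMod 6) : AffineSubspace ℝ E3 :=
  affineSpan ℝ {P (i - 2), P (i - 1), P (i + 1), P (i + 2)}

/-- A boat: for some pair of opposite vertices `P_i, P_{i+3}`, the other four vertices form a
parallelogram, and `P_i, P_{i+3}` lie strictly on the same side of its plane. -/
def IsBoat (P : ZMod 6 → E3) : Prop :=
  ∃ i, IsSeat P i ∧ (seatPlane P i).SSameSide (P i) (P (i + 3))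

/-- A chair: for some pair of opposite vertices `P_i, P_{i+3}`, the other four vertices form a
parallelogram, and `P_i, P_{i+3}` lie strictly on opposite sides of its plane. -/
def IsChair (P : ZMod 6 → E3) : Prop :=
  ∃ i, IsSeat P i ∧ (seatPlane P i).SOppSide (P i) (P (i + 3))

/-!
For `0 < θ ≤ π` the condition on the angles says that the short diagonals `P_{i-1}P_{i+1}` have
squared length `2 - 2 cos θ`, so that the triangles `P₀P₂P₄` and `P₁P₃P₅` are equilateral with
the inradius `r` given by `12 r² = 2 - 2 cos θ`. An orientation preserving isometry puts `P₀P₂P₄`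
into a fixed position. Each of `P₁, P₃, P₅` then moves on a circle about the midpoint of a side of
that triangle, and has a position `(w, v)` with `w² + v² = 1 - 3 r²`. What remains to be required
is that the three mutual distances are right, which is one and the same symmetric relation, of
degree one in each argument, for every pair of positions. These triples form `shapeSpace r`. As the
coordinates `w` and `v` are invariants of the hexagon, a long diagonal and an oriented volume,
`exists_homeomorph_configSpace` identifies the configuration space with `shapeSpace r`.

The positions compatible with a given one are the intersections of a line with a circle, given by
the square roots `q` of a discriminant, which factors as `3 (3r - w) (w - r (24 r² - 5))`. These two
positions are compatible with each other (`neighbour_neighbour`). So the curve `quartic r` of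
triples `(w, v, q)` maps injectively to the space of shapes, and what it misses are exactly the
shapes with three equal positions, for which `w = r` or `w = -3r` (`mem_shapeSpace_cases`,
`quarticShape_ne_const`). The factorization of the discriminant shows that the curve is a circle if
`π / 3 < θ < 2π / 3` and a pair of circles if `θ < π / 3` (`exists_circle_param`,
`exists_two_circles_param`), and there are two or four symmetric shapes respectively. For
`θ = 2π / 3` only one shape is left, and for larger `θ` the discriminant is negative. If `θ = 0`,
the hexagon traverses one edge back and forth.

The symmetric shapes are those whose three long diagonals have equal length (`shape_eq_const_iff`).
The seat of a boat or a chair is a rectangle; if `t = 12 r²`, two of the long diagonals are its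
diagonals, of squared length `1 + t`, and the third one has squared length `1 + t` for a chair and
`(1 - t)²` for a boat (`seat_dichotomy`). So chairs are isolated points, and boats lie on the
circles.
-/

/-! ### The space of shapes and its elliptic component -/

/-- The shapes of equiangular hexagons whose triangles `P₀P₂P₄` and `P₁P₃P₅` have inradius `r`.
The entry `(w, v)` of index `j` says that `P_{2j+1}` lies at distance `v` above the plane of the
triangle `P₀P₂P₄`, over the ray from its centre through the midpoint of `P_{2j}P_{2j+2}`, a signed
distance `w` beyond that midpoint. The first condition says that `P_{2j+1}` is at distance `1` from
its two neighbours, the second one that `P₁P₃P₅` has the side length `√12 r` of `P₀P₂P₄`. -/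
def shapeSpace (r : ℝ) : Set (Fin 3 → ℝ × ℝ) :=
  {p | (∀ i, (p i).1 ^ 2 + (p i).2 ^ 2 = 1 - 3 * r ^ 2) ∧
    ∀ i j, i ≠ j → 2 - 15 * r ^ 2 + 3 * r * ((p i).1 + (p j).1) + (p i).1 * (p j).1
      - 2 * ((p i).2 * (p j).2) = 0}

/-- The curve of positions `(w, v)` of one vertex together with a square root `q` of the
discriminant of the quadratic problem of finding a compatible position of a second one. It is an
intersection of two quadrics, in general an elliptic curve. -/
def quartic (r : ℝ) : Set (ℝ × ℝ × ℝ) :=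
  {e | e.1 ^ 2 + e.2.1 ^ 2 = 1 - 3 * r ^ 2 ∧
    e.2.2 ^ 2 = 3 * (3 * r - e.1) * (e.1 - r * (24 * r ^ 2 - 5))}

/-- The position compatible with `(w, v)` belonging to the square root `q` of the discriminant: the
solution `(W, V)` of the linear system `(3r + w) W - 2 v V = -(2 - 15 r² + 3 r w)`,
`(3r + w) V + 2 v W = q`, by Cramer's rule. -/
noncomputable def neighbour (r w v q : ℝ) : ℝ × ℝ :=
  ((-(2 - 15 * r ^ 2 + 3 * r * w) * (3 * r + w) + 2 * v * q) / ((3 * r + w) ^ 2 + 4 * v ^ 2),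
   ((2 - 15 * r ^ 2 + 3 * r * w) * (2 * v) + (3 * r + w) * q) / ((3 * r + w) ^ 2 + 4 * v ^ 2))

section
variable {r w v q : ℝ}

/-- The linear system defining `neighbour` is regular unless `12 r² = 1`, that is `θ = π / 3`. -/
lemma denom_pos (hr : 12 * r ^ 2 ≠ 1) (h : w ^ 2 + v ^ 2 = 1 - 3 * r ^ 2) :
    0 < (3 * r + w) ^ 2 + 4 * v ^ 2 := by
  rcases eq_or_ne v 0 with rfl | hv
  · have : 3 * r + w ≠ 0 := by
      intro h0
      apply hr
      have : w = -3 * r := by linarith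
      subst this
      linarith
    positivity
  · positivity

lemma neighbour_compat (hr : 12 * r ^ 2 ≠ 1) (h : w ^ 2 + v ^ 2 = 1 - 3 * r ^ 2) :
    2 - 15 * r ^ 2 + 3 * r * (w + (neighbour r w v q).1) + w * (neighbour r w v q).1
      - 2 * (v * (neighbour r w v q).2) = 0 := by
  have h0 := (denom_pos hr h).ne'
  obtain ⟨N, hN⟩ : ∃ N, N = (3 * r + w) ^ 2 + 4 * v ^ 2 := ⟨_, rfl⟩
  simp only [neighbour, ← hN] at h0 ⊢
  field_simp
  linear_combination (2 - 15 * r ^ 2 + 3 * r * w) * hN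

lemma neighbour_cross (hr : 12 * r ^ 2 ≠ 1) (h : w ^ 2 + v ^ 2 = 1 - 3 * r ^ 2) :
    (3 * r + w) * (neighbour r w v q).2 + 2 * v * (neighbour r w v q).1 = q := by
  have h0 := (denom_pos hr h).ne'
  obtain ⟨N, hN⟩ : ∃ N, N = (3 * r + w) ^ 2 + 4 * v ^ 2 := ⟨_, rfl⟩
  simp only [neighbour, ← hN] at h0 ⊢
  field_simp
  linear_combination -q * hN

lemma neighbour_circle (hr : 12 * r ^ 2 ≠ 1) (h : w ^ 2 + v ^ 2 = 1 - 3 * r ^ 2)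
    (hq : q ^ 2 = 3 * (3 * r - w) * (w - r * (24 * r ^ 2 - 5))) :
    (neighbour r w v q).1 ^ 2 + (neighbour r w v q).2 ^ 2 = 1 - 3 * r ^ 2 := by
  have h0 := (denom_pos hr h).ne'
  have hv : v ^ 2 = 1 - 3 * r ^ 2 - w ^ 2 := by linarith
  obtain ⟨N, hN⟩ : ∃ N, N = (3 * r + w) ^ 2 + 4 * v ^ 2 := ⟨_, rfl⟩
  have key : (2 - 15 * r ^ 2 + 3 * r * w) ^ 2 + q ^ 2 = N * (1 - 3 * r ^ 2) := by
    rw [hN, hq, hv]; ring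
  simp only [neighbour, ← hN] at h0 ⊢
  field_simp
  linear_combination N * key - ((2 - 15 * r ^ 2 + 3 * r * w) ^ 2 + q ^ 2) * hN

/-- A closure property in the manner of Poncelet: the two positions compatible with a given one are
compatible with each other. -/
lemma neighbour_neighbour (hr : 12 * r ^ 2 ≠ 1) (h : w ^ 2 + v ^ 2 = 1 - 3 * r ^ 2)
    (hq : q ^ 2 = 3 * (3 * r - w) * (w - r * (24 * r ^ 2 - 5))) :
    2 - 15 * r ^ 2 + 3 * r * ((neighbour r w v q).1 + (neighbour r w v (-q)).1)
      + (neighbour r w v q).1 * (neighbour r w v (-q)).1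
      - 2 * ((neighbour r w v q).2 * (neighbour r w v (-q)).2) = 0 := by
  have h0 := (denom_pos hr h).ne'
  have hv : v ^ 2 = 1 - 3 * r ^ 2 - w ^ 2 := by linarith
  obtain ⟨N, hN⟩ : ∃ N, N = (3 * r + w) ^ 2 + 4 * v ^ 2 := ⟨_, rfl⟩
  simp only [neighbour, ← hN] at h0 ⊢
  have hN' : N = 4 - 3 * r ^ 2 + 6 * r * w - 3 * w ^ 2 := by rw [hN, hv]; ring
  obtain ⟨C, hC⟩ : ∃ C, C = 2 - 15 * r ^ 2 + 3 * r * w := ⟨_, rfl⟩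
  have key : N ^ 2 * (2 - 15 * r ^ 2) - 6 * r * C * (3 * r + w) * N
      + (C ^ 2 * (3 * r + w) ^ 2 - 4 * v ^ 2 * q ^ 2)
      - 2 * (4 * C ^ 2 * v ^ 2 - (3 * r + w) ^ 2 * q ^ 2) = 0 := by
    rw [hN', hq, hv, hC]
    ring
  rw [← hC]
  field_simp
  linear_combination key

lemma eq_neighbour {W V : ℝ} (hr : 12 * r ^ 2 ≠ 1) (h : w ^ 2 + v ^ 2 = 1 - 3 * r ^ 2)
    (hc : 2 - 15 * r ^ 2 + 3 * r * (w + W) + w * W - 2 * (v * V) = 0) :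
    (W, V) = neighbour r w v ((3 * r + w) * V + 2 * v * W) := by
  have h0 := (denom_pos hr h).ne'
  rw [neighbour, Prod.mk.injEq, eq_div_iff h0, eq_div_iff h0]
  constructor
  · linear_combination (3 * r + w) * hc
  · linear_combination (-2 * v) * hc

/-- The discriminant factors, with roots `3r` and `r (24 r² - 5)`. -/
lemma cross_sq {W V : ℝ} (h : w ^ 2 + v ^ 2 = 1 - 3 * r ^ 2) (h' : W ^ 2 + V ^ 2 = 1 - 3 * r ^ 2)
    (hc : 2 - 15 * r ^ 2 + 3 * r * (w + W) + w * W - 2 * (v * V) = 0) :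
    ((3 * r + w) * V + 2 * v * W) ^ 2 = 3 * (3 * r - w) * (w - r * (24 * r ^ 2 - 5)) := by
  have e : ((3 * r + w) * V + 2 * v * W) ^ 2 =
      ((3 * r + w) ^ 2 + 4 * v ^ 2) * (1 - 3 * r ^ 2) - (2 - 15 * r ^ 2 + 3 * r * w) ^ 2 := by
    rw [← h']
    linear_combination (2 - 15 * r ^ 2 + 3 * r * w - ((3 * r + w) * W - 2 * v * V)) * hc
  rw [e]
  linear_combination 4 * (1 - 3 * r ^ 2) * h

/-- The shape formed by a position and the two positions compatible with it. -/
noncomputable def quarticShape (r : ℝ) (e : ℝ × ℝ × ℝ) : Fin 3 → ℝ × ℝ :=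
  ![(e.1, e.2.1), neighbour r e.1 e.2.1 e.2.2, neighbour r e.1 e.2.1 (-e.2.2)]

lemma shapeSpace_mk {a b c : ℝ × ℝ} : ![a, b, c] ∈ shapeSpace r ↔
    (a.1 ^ 2 + a.2 ^ 2 = 1 - 3 * r ^ 2 ∧ b.1 ^ 2 + b.2 ^ 2 = 1 - 3 * r ^ 2 ∧
      c.1 ^ 2 + c.2 ^ 2 = 1 - 3 * r ^ 2) ∧
    2 - 15 * r ^ 2 + 3 * r * (a.1 + b.1) + a.1 * b.1 - 2 * (a.2 * b.2) = 0 ∧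
    2 - 15 * r ^ 2 + 3 * r * (a.1 + c.1) + a.1 * c.1 - 2 * (a.2 * c.2) = 0 ∧
    2 - 15 * r ^ 2 + 3 * r * (b.1 + c.1) + b.1 * c.1 - 2 * (b.2 * c.2) = 0 := by
  constructor
  · rintro ⟨h1, h2⟩
    exact ⟨⟨h1 0, h1 1, h1 2⟩, h2 0 1 (by decide), h2 0 2 (by decide), h2 1 2 (by decide)⟩
  · rintro ⟨⟨ha, hb, hc⟩, hab, hac, hbc⟩
    refine ⟨fun i => ?_, fun i j hij => ?_⟩
    · fin_cases i <;> assumption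
    · fin_cases i <;> fin_cases j
      · exact absurd rfl hij
      · exact hab
      · exact hac
      · simp only [Fin.isValue, Fin.mk_one, Matrix.cons_val_one, Fin.zero_eta, Matrix.cons_val_zero]
        linear_combination hab
      · exact absurd rfl hij
      · exact hbc
      · simp [Matrix.cons_val_zero] at *
        linear_combination hac
      · simp at *
        linear_combination hbc
      · exact absurd rfl hij

lemma quarticShape_mem (hr : 12 * r ^ 2 ≠ 1) {e : ℝ × ℝ × ℝ} (he : e ∈ quartic r) :
    quarticShape r e ∈ shapeSpace r := by
  obtain ⟨h, hq⟩ := he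
  have hq' : (-e.2.2) ^ 2 = 3 * (3 * r - e.1) * (e.1 - r * (24 * r ^ 2 - 5)) := by
    rw [neg_sq, hq]
  exact shapeSpace_mk.2 ⟨⟨h, neighbour_circle hr h hq, neighbour_circle hr h hq'⟩,
    neighbour_compat hr h, neighbour_compat hr h, neighbour_neighbour hr h hq⟩

lemma quarticShape_injOn (hr : 12 * r ^ 2 ≠ 1) : Set.InjOn (quarticShape r) (quartic r) := by
  rintro ⟨w, v, q⟩ ⟨h, -⟩ ⟨w', v', q'⟩ ⟨h', -⟩ heq
  have h0 : (w, v) = (w', v') := congrFun heq 0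
  have h1 : neighbour r w v q = neighbour r w' v' q' := congrFun heq 1
  obtain ⟨rfl, rfl⟩ := Prod.mk.inj h0
  have := neighbour_cross (q := q) hr h
  rw [h1, neighbour_cross hr h'] at this
  rw [this]

/-- The shapes with threefold symmetry. -/
lemma const_mem_shapeSpace {x : ℝ × ℝ} : (fun _ => x) ∈ shapeSpace r ↔
    x.1 ^ 2 + x.2 ^ 2 = 1 - 3 * r ^ 2 ∧ (x.1 = r ∨ x.1 = -3 * r) := by
  constructor
  · rintro ⟨h1, h2⟩
    have h1 := h1 0
    have h2 := h2 0 1 (by decide)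
    refine ⟨h1, ?_⟩
    have : (x.1 - r) * (x.1 - -3 * r) = 0 := by linear_combination (1 / 3) * h2 + (2 / 3) * h1
    rcases mul_eq_zero.1 this with h | h
    · left; linarith
    · right; linarith
  · rintro ⟨h1, h2⟩
    refine ⟨fun _ => h1, fun _ _ _ => ?_⟩
    have : (x.1 - r) * (x.1 - -3 * r) = 0 := by rcases h2 with h | h <;> rw [h] <;> ring
    linear_combination 3 * this - 2 * h1

lemma quarticShape_ne_const (hr0 : r ≠ 0) (hr : 12 * r ^ 2 ≠ 1) (hr' : 4 * r ^ 2 ≠ 1)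
    {e : ℝ × ℝ × ℝ} (he : e ∈ quartic r) (x : ℝ × ℝ) : quarticShape r e ≠ fun _ => x := by
  intro heq
  have hx := const_mem_shapeSpace.1 (heq ▸ quarticShape_mem hr he)
  obtain ⟨h, hq⟩ := he
  have h0 : (e.1, e.2.1) = x := congrFun heq 0
  have h1 : neighbour r e.1 e.2.1 e.2.2 = x := congrFun heq 1
  have h2 : neighbour r e.1 e.2.1 (-e.2.2) = x := congrFun heq 2
  have c1 := neighbour_cross (q := e.2.2) hr h
  have c2 := neighbour_cross (q := -e.2.2) hr h
  rw [h1] at c1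
  rw [h2] at c2
  have hq0 : e.2.2 = 0 := by linarith
  rw [hq0] at hq
  have hw : x.1 = e.1 := by rw [← h0]
  rw [← hw] at hq
  have hn : r * (4 * r ^ 2 - 1) ≠ 0 := mul_ne_zero hr0 (sub_ne_zero.2 hr')
  have hn' : r * (12 * r ^ 2 - 1) ≠ 0 := mul_ne_zero hr0 (sub_ne_zero.2 hr)
  rcases hx.2 with h | h <;> rw [h] at hq
  · exact mul_ne_zero hr0 hn (by linear_combination (1 / 36) * hq)
  · exact mul_ne_zero hr0 hn' (by linear_combination (1 / 36) * hq)

/-- If the second and third position are the two distinct solutions of the quadratic problem posed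
by the first one, or its double solution, the shape comes from the curve. Otherwise they coincide,
the repeated position is that of a symmetric shape, and the first one is either equal to it or the
other position compatible with it. In the latter case the discriminant at the first position
vanishes, so that the shape comes from the curve after all. -/
lemma mem_shapeSpace_cases (hr : 12 * r ^ 2 ≠ 1)
    {p : Fin 3 → ℝ × ℝ} (hp : p ∈ shapeSpace r) :
    (∃ e ∈ quartic r, quarticShape r e = p) ∨ ∃ x, p = fun _ => x := by
  obtain ⟨⟨a, a'⟩, ⟨b, b'⟩, ⟨c, c'⟩, rfl⟩ : ∃ x y z, p = ![x, y, z] :=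
    ⟨p 0, p 1, p 2, by ext i <;> fin_cases i <;> rfl⟩
  obtain ⟨⟨ha, hb, hc⟩, hab, hac, hbc⟩ := shapeSpace_mk.1 hp
  simp only at ha hb hc hab hac hbc
  have hE : (a, a', (3 * r + a) * b' + 2 * a' * b) ∈ quartic r := ⟨ha, cross_sq ha hb hab⟩
  -- The two neighbours of the first point have opposite or equal values of `q`.
  have hq : ((3 * r + a) * c' + 2 * a' * c) ^ 2 = ((3 * r + a) * b' + 2 * a' * b) ^ 2 := by
    rw [cross_sq ha hb hab, cross_sq ha hc hac]
  have eb := eq_neighbour hr ha hab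
  have ec := eq_neighbour hr ha hac
  have opp : (3 * r + a) * c' + 2 * a' * c = -((3 * r + a) * b' + 2 * a' * b) →
      ∃ e ∈ quartic r, quarticShape r e = ![(a, a'), (b, b'), (c, c')] := by
    intro h
    refine ⟨_, hE, ?_⟩
    rw [h] at ec
    simp only [quarticShape]
    rw [← eb, ← ec]
  rcases sq_eq_sq_iff_eq_or_eq_neg.1 hq with h | h
  swap
  · exact Or.inl (opp h)
  rw [h, ← eb] at ec
  obtain ⟨rfl, rfl⟩ := Prod.mk.inj ec
  -- Relative to the repeated point, the other two have equal or opposite values of `q`.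
  have hba : 2 - 15 * r ^ 2 + 3 * r * (c + a) + c * a - 2 * (c' * a') = 0 := by
    linear_combination hab
  have hq2 : ((3 * r + c) * a' + 2 * c' * a) ^ 2 = ((3 * r + c) * c' + 2 * c' * c) ^ 2 := by
    rw [cross_sq hb ha hba, cross_sq hb hb hbc]
  have ea := eq_neighbour hr hb hba
  have eb' := eq_neighbour hr hb hbc
  rcases sq_eq_sq_iff_eq_or_eq_neg.1 hq2 with h2 | h2
  · right
    rw [h2, ← eb'] at ea
    rw [ea]
    exact ⟨(c, c'), by ext i <;> fin_cases i <;> rfl⟩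
  · left
    apply opp
    suffices h0 : (3 * r + a) * c' + 2 * a' * c = 0 by linarith
    have hd : (fun _ => (c, c')) ∈ shapeSpace r := by
      refine ⟨fun _ => hb, fun i j _ => ?_⟩
      exact hbc
    rcases (const_mem_shapeSpace.1 hd).2 with rfl | rfl
    · have hc2 : c' ^ 2 = 1 - 4 * c ^ 2 := by linarith
      have ha1 : a = c * (24 * c ^ 2 - 5) := by
        linear_combination c * hba + (c' / 2) * h2 - (a + 3 * c) * hc2
      have ha2 : a' = c' * (1 - 12 * c ^ 2) := by
        linear_combination c * h2 - (c' / 2) * hba - a' * hc2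
      rw [ha1, ha2]
      ring
    · have hc2 : c' ^ 2 = 1 - 12 * r ^ 2 := by linarith
      have hc0 : c' ≠ 0 := fun h0 => hr (by rw [h0] at hc2; linarith)
      have ha1 : a = 3 * r := mul_left_cancel₀ hc0 (by linear_combination (1 / 2) * h2)
      have ha2 : a' = c' := mul_left_cancel₀ hc0 (by linear_combination (-1 / 2) * hba - hc2)
      rw [ha1, ha2]
      ring

end

/-! ### The topology of the space of shapes -/

/-- A parametrization of the curve by a compact space `K` and an enumeration of the symmetric shapes
together parametrize the space of shapes, the latter corresponding to the points of `Fin n`. -/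
lemma exists_homeomorph_shapeSpace {K : Type*} [TopologicalSpace K] [CompactSpace K] {n : ℕ}
    {r : ℝ} (hr0 : r ≠ 0) (hr : 12 * r ^ 2 ≠ 1) (hr' : 4 * r ^ 2 ≠ 1)
    {c : K → ℝ × ℝ × ℝ} (hc : Continuous c) (hci : Function.Injective c)
    (hcr : Set.range c = quartic r)
    {k : Fin n → ℝ × ℝ} (hki : Function.Injective k)
    (hkr : Set.range k = {x | x.1 ^ 2 + x.2 ^ 2 = 1 - 3 * r ^ 2 ∧ (x.1 = r ∨ x.1 = -3 * r)}) :
    ∃ Φ : shapeSpace r ≃ₜ K ⊕ Fin n,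
      ∀ p, Φ p ∈ Set.range Sum.inr ↔ ∃ x, p.1 = fun _ => x := by
  have hcm : ∀ z, c z ∈ quartic r := fun z => hcr ▸ Set.mem_range_self z
  have hkm : ∀ i, (fun _ => k i) ∈ shapeSpace r := fun i =>
    const_mem_shapeSpace.2 ((Set.ext_iff.1 hkr (k i)).1 ⟨i, rfl⟩)
  let f : K ⊕ Fin n → shapeSpace r :=
    Sum.elim (fun z => ⟨quarticShape r (c z), quarticShape_mem hr (hcm z)⟩)
      (fun i => ⟨fun _ => k i, hkm i⟩)
  have hf : Continuous f := by
    refine continuous_sum_dom.2 ⟨Continuous.subtype_mk ?_ _, continuous_of_discreteTopology⟩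
    refine continuous_pi fun i => ?_
    have h1 : Continuous fun z => (c z).1 := by fun_prop
    have h2 : Continuous fun z => (c z).2.1 := by fun_prop
    have h3 : Continuous fun z => (c z).2.2 := by fun_prop
    have hd : ∀ z, (3 * r + (c z).1) ^ 2 + 4 * (c z).2.1 ^ 2 ≠ 0 :=
      fun z => (denom_pos hr (hcm z).1).ne'
    have hn : ∀ q : K → ℝ, Continuous q →
        Continuous fun z => neighbour r (c z).1 (c z).2.1 (q z) := fun q hq =>
      (Continuous.div (by fun_prop) (by fun_prop) hd).prodMk
        (Continuous.div (by fun_prop) (by fun_prop) hd)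
    fin_cases i
    · exact h1.prodMk h2
    · exact hn _ h3
    · exact hn _ h3.neg
  have hinj : Function.Injective f := by
    rintro (z | i) (z' | i') h <;> have h := congrArg Subtype.val h
    · exact congrArg _ (hci (quarticShape_injOn hr (hcm z) (hcm z') h))
    · exact absurd h (quarticShape_ne_const hr0 hr hr' (hcm z) _)
    · exact absurd h.symm (quarticShape_ne_const hr0 hr hr' (hcm z') _)
    · exact congrArg _ (hki (congrFun h 0))
  have hsurj : Function.Surjective f := by
    rintro ⟨p, hp⟩
    rcases mem_shapeSpace_cases hr hp with ⟨e, he, rfl⟩ | ⟨x, rfl⟩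
    · obtain ⟨z, rfl⟩ := hcr.symm ▸ he
      exact ⟨Sum.inl z, rfl⟩
    · obtain ⟨i, rfl⟩ := (Set.ext_iff.1 hkr x).2 (const_mem_shapeSpace.1 hp)
      exact ⟨Sum.inr i, rfl⟩
  let F := Continuous.homeoOfEquivCompactToT2 (f := Equiv.ofBijective f ⟨hinj, hsurj⟩) hf
  refine ⟨F.symm, fun p => ?_⟩
  obtain ⟨y, rfl⟩ := F.surjective p
  rw [F.symm_apply_apply]
  rcases y with z | i
  · constructor
    · rintro ⟨i, h⟩
      cases h
    · rintro ⟨x, h⟩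
      exact absurd h (quarticShape_ne_const hr0 hr hr' (hcm z) _)
  · exact ⟨fun _ => ⟨k i, rfl⟩, fun _ => ⟨i, rfl⟩⟩

lemma Circle.sq_add_sq (z : Circle) : (z : ℂ).re ^ 2 + (z : ℂ).im ^ 2 = 1 := by
  have := z.normSq_coe
  rw [Complex.normSq_apply] at this
  linarith

lemma Circle.exists_re_im {x y : ℝ} (h : x ^ 2 + y ^ 2 = 1) :
    ∃ z : Circle, (z : ℂ).re = x ∧ (z : ℂ).im = y :=
  ⟨⟨⟨x, y⟩, by
    change (⟨x, y⟩ : ℂ) ∈ Metric.sphere (0 : ℂ) 1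
    rw [mem_sphere_zero_iff_norm, ← sq_eq_sq₀ (norm_nonneg _) zero_le_one, Complex.sq_norm,
      Complex.normSq_apply]
    linarith⟩, rfl, rfl⟩

lemma Circle.ext_re_im {z z' : Circle} (h : (z : ℂ).re = (z' : ℂ).re)
    (h' : (z : ℂ).im = (z' : ℂ).im) : z = z' :=
  Circle.ext (Complex.ext h h')

/-- The lower root of the discriminant lies in the range of `w`, because of the factorization
`r² (24 r² - 5)² - (1 - 3 r²) = (12 r² - 1)² (4 r² - 1)`. -/
lemma abs_root_lt {r : ℝ} (hr : 12 * r ^ 2 ≠ 1) (hr' : 4 * r ^ 2 < 1) :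
    |r * (24 * r ^ 2 - 5)| < √(1 - 3 * r ^ 2) := by
  rw [← Real.sqrt_sq_eq_abs]
  apply Real.sqrt_lt_sqrt (sq_nonneg _)
  have h1 : 0 < (12 * r ^ 2 - 1) ^ 2 := by have := sub_ne_zero.2 hr; positivity
  nlinarith [mul_pos h1 (sub_pos.2 hr')]

/-- For `1 / 12 < r² < 1 / 4` the curve is a circle. With `s = √(1 - 3 r²) < 3 r` and
`l = r (24 r² - 5)` the factors `s + w` and `3 r - w` are positive on it, and division of
`v² = (s - w) (s + w)` and `q² = 3 (3 r - w) (w - l)` by `s + w` and `3 (3 r - w)` gives two squares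
of sum `s - l`. -/
lemma exists_circle_param {r : ℝ} (hr0 : 0 < r) (hr : 1 < 12 * r ^ 2) (hr' : 4 * r ^ 2 < 1) :
    ∃ c : Circle → ℝ × ℝ × ℝ, Continuous c ∧ Function.Injective c ∧
      Set.range c = quartic r := by
  obtain ⟨hl, hu⟩ := abs_lt.1 (abs_root_lt hr.ne' hr')
  have hs : √(1 - 3 * r ^ 2) ^ 2 = 1 - 3 * r ^ 2 := Real.sq_sqrt (by linarith)
  have hs0 : 0 ≤ √(1 - 3 * r ^ 2) := Real.sqrt_nonneg _
  have hr3 : √(1 - 3 * r ^ 2) < 3 * r := by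
    apply lt_of_pow_lt_pow_left₀ 2 (by positivity)
    rw [hs]
    linarith
  obtain ⟨l, hl'⟩ : ∃ l, l = r * (24 * r ^ 2 - 5) := ⟨_, rfl⟩
  obtain ⟨s, hs'⟩ : ∃ s, s = √(1 - 3 * r ^ 2) := ⟨_, rfl⟩
  rw [← hs'] at hs hs0 hr3 hl hu
  simp only [quartic, ← hl', ← hs] at hl hu ⊢
  have hR : √(s - l) ^ 2 = s - l := Real.sq_sqrt (by linarith)
  have hR0 : 0 < √(s - l) := Real.sqrt_pos.2 (by linarith)
  set R := √(s - l)
  clear_value R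
  have hw : ∀ z : Circle, l ≤ s - R ^ 2 * (z : ℂ).re ^ 2 ∧ s - R ^ 2 * (z : ℂ).re ^ 2 ≤ s := by
    intro z
    have h1 := z.sq_add_sq
    have h2 : R ^ 2 = R ^ 2 * (z : ℂ).re ^ 2 + R ^ 2 * (z : ℂ).im ^ 2 := by
      rw [← mul_add, h1, mul_one]
    have h3 : 0 ≤ R ^ 2 * (z : ℂ).re ^ 2 := by positivity
    have h4 : 0 ≤ R ^ 2 * (z : ℂ).im ^ 2 := by positivity
    constructor <;> linarith
  refine ⟨fun z => (s - R ^ 2 * (z : ℂ).re ^ 2,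
    R * (z : ℂ).re * √(s + (s - R ^ 2 * (z : ℂ).re ^ 2)),
    R * (z : ℂ).im * √(3 * (3 * r - (s - R ^ 2 * (z : ℂ).re ^ 2)))), ?_, ?_, ?_⟩
  · have : Continuous ((↑) : Circle → ℂ) := continuous_subtype_val
    have h1 := Complex.continuous_re.comp this
    have h2 := Complex.continuous_im.comp this
    simp only [Function.comp_def] at h1 h2
    fun_prop
  · intro z z' h
    simp only [Prod.mk.injEq] at h
    obtain ⟨h1, h2, h3⟩ := h
    rw [h1] at h2 h3
    have hz := hw z'
    apply Circle.ext_re_im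
    · exact mul_left_cancel₀ hR0.ne' (mul_right_cancel₀ (Real.sqrt_pos.2 (by linarith)).ne' h2)
    · exact mul_left_cancel₀ hR0.ne' (mul_right_cancel₀ (Real.sqrt_pos.2 (by linarith)).ne' h3)
  · ext ⟨w, v, q⟩
    constructor
    · rintro ⟨z, hz⟩
      simp only [Prod.mk.injEq] at hz
      obtain ⟨h1, h2, h3⟩ := hz
      have hz := hw z
      rw [h1] at h2 h3 hz
      change w ^ 2 + v ^ 2 = s ^ 2 ∧ q ^ 2 = 3 * (3 * r - w) * (w - l)
      rw [← h2, ← h3, mul_pow, mul_pow, mul_pow, mul_pow, Real.sq_sqrt (by linarith),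
        Real.sq_sqrt (by linarith)]
      have h4 := z.sq_add_sq
      constructor
      · linear_combination (-(s + w)) * h1
      · linear_combination 3 * (3 * r - w) * (R ^ 2 * h4 + hR + h1)
    · rintro ⟨h1, h2⟩
      simp only at h1 h2
      have hws : |w| ≤ s := abs_le_of_sq_le_sq (by nlinarith [sq_nonneg v]) hs0
      obtain ⟨hw1, hw2⟩ := abs_le.1 hws
      have hwl : l ≤ w := by
        have : 0 ≤ 3 * (3 * r - w) * (w - l) := h2 ▸ sq_nonneg q
        exact sub_nonneg.1 (nonneg_of_mul_nonneg_right this (by linarith))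
      have hv0 : 0 < s + w := by linarith
      have hq0 : 0 < 3 * (3 * r - w) := by linarith
      have a1 := Real.sq_sqrt hv0.le
      have a2 := Real.sq_sqrt hq0.le
      have b1 := Real.sqrt_pos.2 hv0
      have b2 := Real.sqrt_pos.2 hq0
      have hv2 : v ^ 2 = (s - w) * (s + w) := by linear_combination h1
      have e1 : (v / (R * √(s + w))) ^ 2 = (s - w) / R ^ 2 := by
        rw [div_pow, mul_pow, a1, hv2]
        field_simp
      have e2 : (q / (R * √(3 * (3 * r - w)))) ^ 2 = (w - l) / R ^ 2 := by
        rw [div_pow, mul_pow, a2, h2]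
        have : 3 * r - w ≠ 0 := by linarith
        field_simp
      obtain ⟨z, hz1, hz2⟩ := Circle.exists_re_im
        (x := v / (R * √(s + w))) (y := q / (R * √(3 * (3 * r - w)))) (by
          rw [e1, e2, ← add_div, hR]
          have : s - l ≠ 0 := by linarith
          field_simp
          ring)
      have hwz : s - R ^ 2 * (z : ℂ).re ^ 2 = w := by
        rw [hz1, e1]
        field_simp
        ring
      refine ⟨z, Prod.ext hwz (Prod.ext ?_ ?_)⟩
      · simp only [hwz]
        rw [hz1]
        field_simp
      · simp only [hwz]
        rw [hz2]
        field_simp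

/-- For `r² < 1 / 12` the curve consists of two circles: `(w, q)` traverses an ellipse on which
`w² < 1 - 3 r²`, and `v` is one of the two square roots of `1 - 3 r² - w²`, neither of which
vanishes. -/
lemma exists_two_circles_param {r : ℝ} (hr0 : 0 < r) (hr : 12 * r ^ 2 < 1) :
    ∃ c : Circle ⊕ Circle → ℝ × ℝ × ℝ, Continuous c ∧ Function.Injective c ∧
      Set.range c = quartic r := by
  obtain ⟨hl, hu⟩ := abs_lt.1 (abs_root_lt hr.ne (by linarith))
  have hs : √(1 - 3 * r ^ 2) ^ 2 = 1 - 3 * r ^ 2 := Real.sq_sqrt (by linarith)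
  have hs0 : 0 ≤ √(1 - 3 * r ^ 2) := Real.sqrt_nonneg _
  have hr3 : 3 * r < √(1 - 3 * r ^ 2) := by
    apply lt_of_pow_lt_pow_left₀ 2 hs0
    rw [hs]
    linarith
  have hlr : r * (24 * r ^ 2 - 5) < 3 * r := by nlinarith
  obtain ⟨l, hl'⟩ : ∃ l, l = r * (24 * r ^ 2 - 5) := ⟨_, rfl⟩
  obtain ⟨s, hs'⟩ : ∃ s, s = √(1 - 3 * r ^ 2) := ⟨_, rfl⟩
  rw [← hs'] at hs hs0 hr3 hl hu
  simp only [quartic, ← hl', ← hs] at hl hu hlr ⊢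
  obtain ⟨m, hm⟩ : ∃ m, m = (3 * r + l) / 2 := ⟨_, rfl⟩
  obtain ⟨R, hR⟩ : ∃ R, R = (3 * r - l) / 2 := ⟨_, rfl⟩
  have hR0 : 0 < R := by linarith
  have h3 : √(3 : ℝ) ^ 2 = 3 := Real.sq_sqrt (by norm_num)
  have h30 : 0 < √(3 : ℝ) := Real.sqrt_pos.2 (by norm_num)
  have hw : ∀ z : Circle, 0 < s ^ 2 - (m + R * (z : ℂ).re) ^ 2 := by
    intro z
    have h1 : |(z : ℂ).re| ≤ 1 := z.norm_coe ▸ Complex.abs_re_le_norm z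
    obtain ⟨h2, h3⟩ := abs_le.1 h1
    have : |m + R * (z : ℂ).re| < s := by
      rw [abs_lt]
      constructor <;> nlinarith
    rw [sub_pos]
    exact sq_lt_sq' (abs_lt.1 this).1 (abs_lt.1 this).2
  -- The upper and lower circle, distinguished by the sign `ε` of `v`.
  let g : ℝ → Circle → ℝ × ℝ × ℝ := fun ε z => (m + R * (z : ℂ).re,
    ε * √(s ^ 2 - (m + R * (z : ℂ).re) ^ 2), √3 * R * (z : ℂ).im)
  have gc : ∀ ε, Continuous (g ε) := by
    intro ε
    have : Continuous ((↑) : Circle → ℂ) := continuous_subtype_val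
    have h1 := Complex.continuous_re.comp this
    have h2 := Complex.continuous_im.comp this
    simp only [Function.comp_def] at h1 h2
    fun_prop
  have gi : ∀ ε, Function.Injective (g ε) := by
    intro ε z z' h
    simp only [g, Prod.mk.injEq] at h
    obtain ⟨h1, -, h3⟩ := h
    exact Circle.ext_re_im (mul_left_cancel₀ hR0.ne' (add_left_cancel h1))
      (mul_left_cancel₀ (mul_pos h30 hR0).ne' h3)
  have gmem : ∀ ε, ε ^ 2 = 1 → ∀ z,
      (g ε z).1 ^ 2 + (g ε z).2.1 ^ 2 = s ^ 2 ∧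
        (g ε z).2.2 ^ 2 = 3 * (3 * r - (g ε z).1) * ((g ε z).1 - l) := by
    intro ε hε z
    simp only [g, mul_pow, hε, Real.sq_sqrt (hw z).le, h3]
    have h4 := z.sq_add_sq
    constructor
    · ring
    · subst hm hR
      linear_combination 3 * ((3 * r - l) / 2) ^ 2 * h4
  have gne : ∀ z z', g 1 z ≠ g (-1) z' := by
    intro z z' h
    simp only [g, Prod.mk.injEq] at h
    have h1 := Real.sqrt_pos.2 (hw z)
    have h2 := Real.sqrt_pos.2 (hw z')
    linarith [h.2.1]
  refine ⟨Sum.elim (g 1) (g (-1)), continuous_sum_dom.2 ⟨gc 1, gc (-1)⟩, ?_, ?_⟩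
  · rintro (z | z) (z' | z') h
    · exact congrArg _ (gi _ h)
    · exact absurd h (gne _ _)
    · exact absurd h.symm (gne _ _)
    · exact congrArg _ (gi _ h)
  · refine Set.Subset.antisymm ?_ ?_
    · rintro _ ⟨z | z, rfl⟩
      · exact gmem 1 (by norm_num) z
      · exact gmem (-1) (by norm_num) z
    · rintro ⟨w, v, q⟩ ⟨h1, h2⟩
      simp only at h1 h2
      obtain ⟨z, hz1, hz2⟩ := Circle.exists_re_im (x := (w - m) / R) (y := q / (√3 * R)) (by
        rw [div_pow, div_pow, mul_pow, h3, h2]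
        field_simp
        subst hm hR
        ring)
      have hwz : m + R * (z : ℂ).re = w := by
        rw [hz1]
        field_simp
        ring
      have hqz : √3 * R * (z : ℂ).im = q := by
        rw [hz2]
        field_simp
      have hv : √(s ^ 2 - w ^ 2) = |v| := by
        rw [← h1, add_sub_cancel_left, Real.sqrt_sq_eq_abs]
      rcases abs_choice v with h | h
      · exact ⟨Sum.inl z, by simp [g, hwz, hqz, hv, h]⟩
      · exact ⟨Sum.inr z, by simp [g, hwz, hqz, hv, h]⟩

lemma shapeSpace_homeomorph_circle {r : ℝ} (hr0 : 0 < r) (hr : 1 < 12 * r ^ 2)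
    (hr' : 4 * r ^ 2 < 1) :
    ∃ Φ : shapeSpace r ≃ₜ Circle ⊕ Fin 2,
      ∀ p, Φ p ∈ Set.range Sum.inr ↔ ∃ x, p.1 = fun _ => x := by
  obtain ⟨c, hc, hci, hcr⟩ := exists_circle_param hr0 hr hr'
  have h1 : 0 < 1 - 4 * r ^ 2 := by linarith
  have h1s := Real.sqrt_pos.2 h1
  have h1q := Real.sq_sqrt h1.le
  refine exists_homeomorph_shapeSpace hr0.ne' hr.ne' hr'.ne hc hci hcr
    (k := ![(r, √(1 - 4 * r ^ 2)), (r, -√(1 - 4 * r ^ 2))]) ?_ ?_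
  · intro i j h
    fin_cases i <;> fin_cases j <;> simp at h ⊢ <;> linarith
  · ext ⟨w, v⟩
    constructor
    · rintro ⟨i, h⟩
      fin_cases i <;> simp at h <;> obtain ⟨rfl, rfl⟩ := h <;>
        exact ⟨by simp only [neg_sq]; linarith, Or.inl rfl⟩
    · rintro ⟨h, rfl | rfl⟩
      · rcases sq_eq_sq_iff_eq_or_eq_neg.1 (show v ^ 2 = √(1 - 4 * w ^ 2) ^ 2 by
          simp only at h; linarith) with h | h
        · exact ⟨0, by rw [h]; rfl⟩
        · exact ⟨1, by rw [h]; rfl⟩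
      · simp only at h
        nlinarith [sq_nonneg v]

lemma shapeSpace_homeomorph_two_circles {r : ℝ} (hr0 : 0 < r) (hr : 12 * r ^ 2 < 1) :
    ∃ Φ : shapeSpace r ≃ₜ (Circle ⊕ Circle) ⊕ Fin 4,
      ∀ p, Φ p ∈ Set.range Sum.inr ↔ ∃ x, p.1 = fun _ => x := by
  obtain ⟨c, hc, hci, hcr⟩ := exists_two_circles_param hr0 hr
  have h1 : 0 < 1 - 4 * r ^ 2 := by linarith
  have h1s := Real.sqrt_pos.2 h1
  have h1q := Real.sq_sqrt h1.le
  have h2 : 0 < 1 - 12 * r ^ 2 := by linarith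
  have h2s := Real.sqrt_pos.2 h2
  have h2q := Real.sq_sqrt h2.le
  refine exists_homeomorph_shapeSpace hr0.ne' hr.ne (by linarith) hc hci hcr
    (k := ![(r, √(1 - 4 * r ^ 2)), (r, -√(1 - 4 * r ^ 2)),
      (-3 * r, √(1 - 12 * r ^ 2)), (-3 * r, -√(1 - 12 * r ^ 2))]) ?_ ?_
  · intro i j h
    fin_cases i <;> fin_cases j <;> simp at h ⊢ <;> linarith
  · ext ⟨w, v⟩
    constructor
    · rintro ⟨i, h⟩
      fin_cases i <;> simp at h <;> obtain ⟨rfl, rfl⟩ := h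
      · exact ⟨by simp only; linarith, Or.inl rfl⟩
      · exact ⟨by simp only [neg_sq]; linarith, Or.inl rfl⟩
      · exact ⟨by simp only [neg_sq]; linarith, Or.inr (by ring)⟩
      · exact ⟨by simp only [neg_sq]; linarith, Or.inr (by ring)⟩
    · rintro ⟨h, h' | h'⟩ <;> simp only at h h'
      · subst h'
        rcases sq_eq_sq_iff_eq_or_eq_neg.1 (show v ^ 2 = √(1 - 4 * w ^ 2) ^ 2 by linarith)
          with h | h
        · exact ⟨0, by rw [h]; rfl⟩
        · exact ⟨1, by rw [h]; rfl⟩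
      · subst h'
        rcases sq_eq_sq_iff_eq_or_eq_neg.1 (show v ^ 2 = √(1 - 12 * r ^ 2) ^ 2 by linarith)
          with h | h
        · exact ⟨2, by rw [h]; rfl⟩
        · exact ⟨3, by rw [h]; rfl⟩

/-- The discriminant at each position of a shape is nonnegative, being a square. -/
lemma root_le_of_mem_shapeSpace {r : ℝ} (hr : 1 < 12 * r ^ 2) (hr0 : 0 < r)
    {p : Fin 3 → ℝ × ℝ} (hp : p ∈ shapeSpace r) (i : Fin 3) :
    r * (24 * r ^ 2 - 5) ≤ (p i).1 := by
  obtain ⟨j, hj⟩ : ∃ j, i ≠ j := by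
    fin_cases i
    · exact ⟨1, by decide⟩
    · exact ⟨0, by decide⟩
    · exact ⟨0, by decide⟩
  have h1 := hp.1 i
  have h := cross_sq h1 (hp.1 j) (hp.2 i j hj)
  have h3 : (p i).1 < 3 * r := by
    apply lt_of_pow_lt_pow_left₀ 2 (by positivity)
    nlinarith [sq_nonneg (p i).2]
  have : 0 ≤ 3 * (3 * r - (p i).1) * ((p i).1 - r * (24 * r ^ 2 - 5)) := h ▸ sq_nonneg _
  exact sub_nonneg.1 (nonneg_of_mul_nonneg_right this (by linarith))

lemma shapeSpace_eq_empty {r : ℝ} (hr0 : 0 < r) (hr : 1 < 4 * r ^ 2) : shapeSpace r = ∅ := by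
  refine Set.eq_empty_of_forall_notMem fun p hp => ?_
  have h := root_le_of_mem_shapeSpace (by linarith) hr0 hp 0
  have h1 := hp.1 0
  have h2 : r < (p 0).1 := lt_of_lt_of_le (by nlinarith) h
  nlinarith [sq_nonneg (p 0).2]

/-- The planar regular hexagon is the only one with all angles `2π / 3`. -/
lemma shapeSpace_half : shapeSpace (1 / 2) = {fun _ => (1 / 2, 0)} := by
  ext p
  rw [Set.mem_singleton_iff]
  constructor
  · intro hp
    funext i
    have h := root_le_of_mem_shapeSpace (by norm_num) (by norm_num) hp i
    have h1 := hp.1 i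
    have h2 : (p i).2 = 0 := by
      have : (p i).2 ^ 2 ≤ 0 := by nlinarith
      exact pow_eq_zero_iff two_ne_zero |>.1 (le_antisymm this (sq_nonneg _))
    rw [h2] at h1
    exact Prod.ext (by nlinarith) h2
  · rintro rfl
    exact const_mem_shapeSpace.2 (by norm_num)

/-! ### Rigid motions of three-space -/

lemma E3.dist_sq (x y : E3) :
    dist x y ^ 2 = (x 0 - y 0) ^ 2 + (x 1 - y 1) ^ 2 + (x 2 - y 2) ^ 2 := by
  rw [EuclideanSpace.dist_eq, Real.sq_sqrt (by positivity), Fin.sum_univ_three]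
  simp only [Real.dist_eq, sq_abs]

/-- Rotations act transitively on pairs of orthogonal unit vectors. -/
lemma exists_rotation {e f : E3} (he : ‖e‖ = 1) (hf : ‖f‖ = 1) (hef : inner ℝ e f = 0) :
    ∃ L : E3 ≃ₗᵢ[ℝ] E3, 0 < LinearMap.det (L.toLinearEquiv : E3 →ₗ[ℝ] E3) ∧
      L e = EuclideanSpace.single 0 1 ∧ L f = EuclideanSpace.single 1 1 := by
  have hv : Orthonormal ℝ (({0, 1} : Set (Fin 3)).domRestrict ![e, f, 0]) := by
    constructor
    · rintro ⟨i, rfl | rfl⟩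
      · simpa using he
      · simpa using hf
    · rintro ⟨i, rfl | rfl⟩ ⟨j, rfl | rfl⟩ hij
      · exact absurd rfl hij
      · simpa using hef
      · simpa [real_inner_comm] using hef
      · exact absurd rfl hij
  obtain ⟨b, hb⟩ := hv.exists_orthonormalBasis_extension_of_card_eq (by simp)
  have h0 : b.repr e = EuclideanSpace.single 0 1 := by
    rw [show e = b 0 from (hb 0 (by simp)).symm, b.repr_self]
  have h1 : b.repr f = EuclideanSpace.single 1 1 := by
    rw [show f = b 1 from (hb 1 (by simp)).symm, b.repr_self]
  have hd : LinearMap.det (b.repr.toLinearEquiv : E3 →ₗ[ℝ] E3) ≠ 0 :=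
    (LinearEquiv.isUnit_det' _).ne_zero
  rcases hd.lt_or_gt with hd | hd
  · -- A reflection fixing the first two coordinate vectors corrects the orientation.
    let K : Submodule ℝ E3 := (ℝ ∙ (EuclideanSpace.single 2 1 : E3))ᗮ
    have hK : LinearMap.det (K.reflection.toLinearEquiv : E3 →ₗ[ℝ] E3) = -1 := by
      have h := K.det_reflection
      rw [Submodule.orthogonal_orthogonal, finrank_span_singleton (by simp), pow_one] at h
      exact h
    have hfix : ∀ i : Fin 3, i ≠ 2 → K.reflection (EuclideanSpace.single i 1) =
        EuclideanSpace.single i 1 := by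
      intro i hi
      apply Submodule.reflection_mem_subspace_eq_self
      rw [Submodule.mem_orthogonal_singleton_iff_inner_right]
      rw [EuclideanSpace.inner_single_left]
      simp [hi.symm]
    refine ⟨b.repr.trans K.reflection, ?_, ?_, ?_⟩
    · have : ((b.repr.trans K.reflection).toLinearEquiv : E3 →ₗ[ℝ] E3) =
        (K.reflection.toLinearEquiv : E3 →ₗ[ℝ] E3) ∘ₗ (b.repr.toLinearEquiv : E3 →ₗ[ℝ] E3) := rfl
      rw [this, LinearMap.det_comp, hK]
      linarith
    · rw [LinearIsometryEquiv.trans_apply, h0, hfix 0 (by decide)]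
    · rw [LinearIsometryEquiv.trans_apply, h1, hfix 1 (by decide)]
  · exact ⟨b.repr, hd, h0, h1⟩

lemma exists_orientationPreserving (L : E3 ≃ₗᵢ[ℝ] E3)
    (hL : 0 < LinearMap.det (L.toLinearEquiv : E3 →ₗ[ℝ] E3)) (o : E3) :
    ∃ g ∈ orientationPreserving, ∀ x, g x = L (x - o) := by
  refine ⟨(AffineIsometryEquiv.vaddConst ℝ o).symm.trans L.toAffineIsometryEquiv, ?_,
    fun x => rfl⟩
  exact hL

/-- The oriented volume of the parallelepiped spanned by three vectors of three-space. -/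
def tripleProduct (x y z : E3) : ℝ :=
  x 0 * (y 1 * z 2 - y 2 * z 1) - x 1 * (y 0 * z 2 - y 2 * z 0) + x 2 * (y 0 * z 1 - y 1 * z 0)

lemma tripleProduct_eq_det (x y z : E3) :
    tripleProduct x y z = (EuclideanSpace.basisFun (Fin 3) ℝ).toBasis.det ![x, y, z] := by
  rw [Module.Basis.det_apply, Matrix.det_fin_three]
  simp [Module.Basis.toMatrix_apply, tripleProduct]
  ring

lemma tripleProduct_map {g : E3 ≃ᵃⁱ[ℝ] E3} (hg : g ∈ orientationPreserving) (a b c d : E3) :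
    tripleProduct (g b - g a) (g c - g a) (g d - g a) = tripleProduct (b - a) (c - a) (d - a) := by
  have h1 : LinearMap.det (g.linearIsometryEquiv.toLinearEquiv : E3 →ₗ[ℝ] E3) = 1 := by
    have h := g.linearIsometryEquiv.toLinearIsometry.normDet_eq_one
    rw [LinearMap.normDet_eq_abs_det] at h
    have hg' : 0 < LinearMap.det (g.linearIsometryEquiv.toLinearEquiv : E3 →ₗ[ℝ] E3) := hg
    rw [← abs_of_pos hg']
    exact h
  have h2 : ∀ x, g x - g a = g.linearIsometryEquiv (x - a) := fun x =>
    (g.map_vsub x a).symm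
  rw [h2, h2, h2, tripleProduct_eq_det, tripleProduct_eq_det]
  have := (EuclideanSpace.basisFun (Fin 3) ℝ).toBasis.det_comp
    (g.linearIsometryEquiv.toLinearEquiv : E3 →ₗ[ℝ] E3) ![b - a, c - a, d - a]
  rw [h1, one_mul] at this
  rw [← this]
  congr 1
  ext i
  fin_cases i <;> rfl

/-! ### Normal forms of equiangular hexagons -/

/-- Hexagons with unit sides and short diagonals of length `√12 r`. These are the equiangular
unit hexagons with angle `θ`, where `12 r² = 2 - 2 cos θ`, and the triangles formed by alternate
vertices have inradius `r`. -/
def IsHexagon (r : ℝ) (P : ZMod 6 → E3) : Prop :=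
  ∀ i, dist (P i) (P (i + 1)) ^ 2 = 1 ∧ dist (P (i - 1)) (P (i + 1)) ^ 2 = 12 * r ^ 2

lemma mem_polygons_iff {θ r : ℝ} (h0 : 0 ≤ θ) (hπ : θ ≤ Real.pi)
    (hr : 12 * r ^ 2 = 2 - 2 * Real.cos θ) (P : ZMod 6 → E3) :
    P ∈ Polygons 6 θ ↔ IsHexagon r P := by
  have key : ∀ x y z : E3, dist y z = 1 → dist x y = 1 →
      (∠ x y z = θ ↔ dist x z ^ 2 = 12 * r ^ 2) := by
    intro x y z h1 h2
    have := EuclideanGeometry.law_cos x y z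
    rw [dist_comm z y, h1, h2] at this
    rw [sq, this, hr]
    constructor
    · rintro rfl
      ring
    · intro h
      exact Real.injOn_cos ⟨EuclideanGeometry.angle_nonneg _ _ _, EuclideanGeometry.angle_le_pi _ _ _⟩
        ⟨h0, hπ⟩ (by linarith)
  constructor
  · intro h i
    have h1 := (h (i - 1)).1
    rw [sub_add_cancel] at h1
    exact ⟨by rw [(h i).1, one_pow], (key _ _ _ (h i).1 h1).1 (h i).2⟩
  · intro h i
    have h1 : ∀ i, dist (P i) (P (i + 1)) = 1 := fun i =>
      (pow_eq_one_iff_of_nonneg dist_nonneg two_ne_zero).1 (h i).1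
    have h2 := h1 (i - 1)
    rw [sub_add_cancel] at h2
    exact ⟨h1 i, (key _ _ _ (h1 i) h2).2 (h i).2⟩

/-- The hexagon of a given shape in normal position: the triangle `P₀P₂P₄` is centred at the origin
of the coordinate plane of the first two coordinates, with `P₁` over the first axis. -/
noncomputable def standardHexagon (r : ℝ) (p : Fin 3 → ℝ × ℝ) : ZMod 6 → E3 :=
  ![!₂[r, -(√3 * r), 0],
    !₂[r + (p 0).1, 0, (p 0).2],
    !₂[r, √3 * r, 0],
    !₂[-(r + (p 1).1) / 2, √3 * (r + (p 1).1) / 2, (p 1).2],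
    !₂[-2 * r, 0, 0],
    !₂[-(r + (p 2).1) / 2, -(√3 * (r + (p 2).1)) / 2, (p 2).2]]

lemma isHexagon_iff {r : ℝ} {P : ZMod 6 → E3} : IsHexagon r P ↔
    (dist (P 0) (P 1) ^ 2 = 1 ∧ dist (P 1) (P 2) ^ 2 = 1 ∧ dist (P 2) (P 3) ^ 2 = 1 ∧
      dist (P 3) (P 4) ^ 2 = 1 ∧ dist (P 4) (P 5) ^ 2 = 1 ∧ dist (P 5) (P 0) ^ 2 = 1) ∧
    dist (P 0) (P 2) ^ 2 = 12 * r ^ 2 ∧ dist (P 2) (P 4) ^ 2 = 12 * r ^ 2 ∧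
    dist (P 4) (P 0) ^ 2 = 12 * r ^ 2 ∧ dist (P 1) (P 3) ^ 2 = 12 * r ^ 2 ∧
    dist (P 3) (P 5) ^ 2 = 12 * r ^ 2 ∧ dist (P 5) (P 1) ^ 2 = 12 * r ^ 2 := by
  constructor
  · intro h
    exact ⟨⟨(h 0).1, (h 1).1, (h 2).1, (h 3).1, (h 4).1, (h 5).1⟩,
      (h 1).2, (h 3).2, (h 5).2, (h 2).2, (h 4).2, (h 0).2⟩
  · rintro ⟨⟨h0, h1, h2, h3, h4, h5⟩, k1, k3, k5, k2, k4, k0⟩ i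
    fin_cases i
    · exact ⟨h0, k0⟩
    · exact ⟨h1, k1⟩
    · exact ⟨h2, k2⟩
    · exact ⟨h3, k3⟩
    · exact ⟨h4, k4⟩
    · exact ⟨h5, k5⟩

section
variable (r : ℝ) (p : Fin 3 → ℝ × ℝ)

lemma standardHexagon_zero : standardHexagon r p 0 = !₂[r, -(√3 * r), 0] := rfl
lemma standardHexagon_one : standardHexagon r p 1 = !₂[r + (p 0).1, 0, (p 0).2] := rfl
lemma standardHexagon_two : standardHexagon r p 2 = !₂[r, √3 * r, 0] := rfl
lemma standardHexagon_three : standardHexagon r p 3 =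
    !₂[-(r + (p 1).1) / 2, √3 * (r + (p 1).1) / 2, (p 1).2] := rfl
lemma standardHexagon_four : standardHexagon r p 4 = !₂[-2 * r, 0, 0] := rfl
lemma standardHexagon_five : standardHexagon r p 5 =
    !₂[-(r + (p 2).1) / 2, -(√3 * (r + (p 2).1)) / 2, (p 2).2] := rfl

end

lemma isHexagon_standardHexagon {r : ℝ} {p : Fin 3 → ℝ × ℝ} :
    IsHexagon r (standardHexagon r p) ↔ p ∈ shapeSpace r := by
  obtain ⟨a, b, c, rfl⟩ : ∃ x y z, p = ![x, y, z] :=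
    ⟨p 0, p 1, p 2, by ext i <;> fin_cases i <;> rfl⟩
  have h3 : √(3 : ℝ) ^ 2 = 3 := Real.sq_sqrt (by norm_num)
  rw [isHexagon_iff, shapeSpace_mk, standardHexagon_zero, standardHexagon_one,
    standardHexagon_two, standardHexagon_three, standardHexagon_four, standardHexagon_five]
  simp only [E3.dist_sq, Matrix.cons_val]
  constructor
  · rintro ⟨⟨k0, -, k2, -, k4, -⟩, -, -, -, k13, k35, k51⟩
    have ha : a.1 ^ 2 + a.2 ^ 2 = 1 - 3 * r ^ 2 := by linear_combination k0 - r ^ 2 * h3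
    have hb : b.1 ^ 2 + b.2 ^ 2 = 1 - 3 * r ^ 2 := by
      linear_combination k2 - ((r - b.1) / 2) ^ 2 * h3
    have hc : c.1 ^ 2 + c.2 ^ 2 = 1 - 3 * r ^ 2 := by
      linear_combination k4 - ((r + c.1) / 2) ^ 2 * h3
    refine ⟨⟨ha, hb, hc⟩, ?_, ?_, ?_⟩
    · linear_combination k13 - ha - hb - ((r + b.1) / 2) ^ 2 * h3
    · linear_combination k51 - ha - hc - ((r + c.1) / 2) ^ 2 * h3
    · linear_combination k35 - hb - hc - ((r + b.1 + (r + c.1)) / 2) ^ 2 * h3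
  · rintro ⟨⟨ha, hb, hc⟩, hab, hac, hbc⟩
    refine ⟨⟨?_, ?_, ?_, ?_, ?_, ?_⟩, ?_, ?_, ?_, ?_, ?_, ?_⟩
    · linear_combination ha + r ^ 2 * h3
    · linear_combination ha + r ^ 2 * h3
    · linear_combination hb + ((r - b.1) / 2) ^ 2 * h3
    · linear_combination hb + ((r + b.1) / 2) ^ 2 * h3
    · linear_combination hc + ((r + c.1) / 2) ^ 2 * h3
    · linear_combination hc + ((r - c.1) / 2) ^ 2 * h3
    · linear_combination 4 * r ^ 2 * h3
    · linear_combination r ^ 2 * h3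
    · linear_combination r ^ 2 * h3
    · linear_combination hab + ha + hb + ((r + b.1) / 2) ^ 2 * h3
    · linear_combination hbc + hb + hc + ((r + b.1 + (r + c.1)) / 2) ^ 2 * h3
    · linear_combination hac + ha + hc + ((r + c.1) / 2) ^ 2 * h3

/-- An equilateral triangle can be moved to the standard position. -/
lemma exists_motion_triangle {r : ℝ} (hr : 0 < r) {a b c : E3}
    (hab : dist a b ^ 2 = 12 * r ^ 2) (hbc : dist b c ^ 2 = 12 * r ^ 2)
    (hca : dist c a ^ 2 = 12 * r ^ 2) :
    ∃ g ∈ orientationPreserving, g a = !₂[r, -(√3 * r), 0] ∧ g b = !₂[r, √3 * r, 0] ∧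
      g c = !₂[-2 * r, 0, 0] := by
  have h3 : √(3 : ℝ) ^ 2 = 3 := Real.sq_sqrt (by norm_num)
  have h30 : √(3 : ℝ) ≠ 0 := by positivity
  have hr0 := hr.ne'
  have ha : inner ℝ (a - c) (a - c) = 12 * r ^ 2 := by
    rw [real_inner_self_eq_norm_sq, ← dist_eq_norm, dist_comm, hca]
  have hb : inner ℝ (b - c) (b - c) = 12 * r ^ 2 := by
    rw [real_inner_self_eq_norm_sq, ← dist_eq_norm, hbc]
  have hab' : inner ℝ (a - c) (b - c) = 6 * r ^ 2 := by
    have h : dist a b ^ 2 = ‖(a - c) - (b - c)‖ ^ 2 := by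
      rw [dist_eq_norm, sub_sub_sub_cancel_right]
    rw [norm_sub_sq_real, ← real_inner_self_eq_norm_sq, ← real_inner_self_eq_norm_sq,
      ha, hb, hab] at h
    linarith
  -- `u + v` points along the axis of symmetry through `c`, and `v - u` along the side `a b`.
  obtain ⟨u, hu⟩ : ∃ u, u = a - c := ⟨_, rfl⟩
  obtain ⟨v, hv⟩ : ∃ v, v = b - c := ⟨_, rfl⟩
  rw [← hu, ← hv] at hab'
  rw [← hu] at ha
  rw [← hv] at hb
  have hba' : inner ℝ v u = 6 * r ^ 2 := by rw [real_inner_comm, hab']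
  obtain ⟨L, hL, hLe, hLf⟩ := exists_rotation
    (e := (1 / (6 * r)) • (u + v)) (f := (1 / (2 * √3 * r)) • (v - u))
    (by
      rw [← sq_eq_sq₀ (norm_nonneg _) zero_le_one, ← real_inner_self_eq_norm_sq]
      simp only [inner_add_left, inner_add_right, inner_smul_left, inner_smul_right, ha, hb,
        hab', hba', RCLike.conj_to_real]
      field_simp
      norm_num)
    (by
      rw [← sq_eq_sq₀ (norm_nonneg _) zero_le_one, ← real_inner_self_eq_norm_sq]
      simp only [inner_sub_left, inner_sub_right, inner_smul_left, inner_smul_right, ha, hb,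
        hab', hba', RCLike.conj_to_real]
      field_simp
      rw [h3]
      norm_num)
    (by
      simp only [inner_sub_right, inner_add_left, inner_smul_left, inner_smul_right, ha, hb,
        hab', hba']
      ring)
  obtain ⟨g, hg, hgL⟩ := exists_orientationPreserving L hL ((1 / 3 : ℝ) • (a + b + c))
  have huv : L (u + v) = (6 * r) • EuclideanSpace.single 0 1 := by
    rw [← hLe, ← map_smul, smul_smul, mul_one_div_cancel (by positivity), one_smul]
  have hvu : L (v - u) = (2 * √3 * r) • EuclideanSpace.single 1 1 := by
    rw [← hLf, ← map_smul, smul_smul, mul_one_div_cancel (by positivity), one_smul]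
  refine ⟨g, hg, ?_, ?_, ?_⟩
  · have e : a - (1 / 3 : ℝ) • (a + b + c) =
        (1 / 6 : ℝ) • (u + v) - (1 / 2 : ℝ) • (v - u) := by
      rw [hu, hv]
      module
    rw [hgL, e, map_sub, map_smul, map_smul, huv, hvu]
    ext i
    fin_cases i <;> simp <;> ring
  · have e : b - (1 / 3 : ℝ) • (a + b + c) =
        (1 / 6 : ℝ) • (u + v) + (1 / 2 : ℝ) • (v - u) := by
      rw [hu, hv]
      module
    rw [hgL, e, map_add, map_smul, map_smul, huv, hvu]
    ext i
    fin_cases i <;> simp <;> ring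
  · have e : c - (1 / 3 : ℝ) • (a + b + c) = (-1 / 3 : ℝ) • (u + v) := by
      rw [hu, hv]
      module
    rw [hgL, e, map_smul, huv]
    ext i
    fin_cases i <;> simp
    ring

lemma IsHexagon.exists_standardHexagon {r : ℝ} (hr : 0 < r) {P : ZMod 6 → E3}
    (hP : IsHexagon r P) :
    ∃ p ∈ shapeSpace r, ∃ g ∈ orientationPreserving, ∀ i, g (P i) = standardHexagon r p i := by
  have h3 : √(3 : ℝ) ^ 2 = 3 := Real.sq_sqrt (by norm_num)
  have h30 : √(3 : ℝ) ≠ 0 := by positivity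
  obtain ⟨⟨k0, k1, k2, k3, k4, k5⟩, l0, l2, l4, -⟩ := isHexagon_iff.1 hP
  obtain ⟨g, hg, h0, h2, h4⟩ := exists_motion_triangle hr l0 l2 l4
  rw [← g.dist_map] at k0 k1 k2 k3 k4 k5
  rw [h0] at k0 k5
  rw [h2] at k1 k2
  rw [h4] at k3 k4
  simp only [E3.dist_sq, Matrix.cons_val] at k0 k1 k2 k3 k4 k5
  let p : Fin 3 → ℝ × ℝ := ![(g (P 1) 0 - r, g (P 1) 2), (-2 * g (P 3) 0 - r, g (P 3) 2),
    (-2 * g (P 5) 0 - r, g (P 5) 2)]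
  have hgp : ∀ i, g (P i) = standardHexagon r p i := by
    have e1 : g (P 1) 1 = 0 := by
      apply mul_left_cancel₀ (mul_ne_zero h30 hr.ne')
      linear_combination (1 / 4) * k0 - (1 / 4) * k1
    have e3 : g (P 3) 1 = -(√3 * g (P 3) 0) := by
      apply mul_left_cancel₀ (mul_ne_zero h30 hr.ne')
      linear_combination (-1 / 2) * k2 + (1 / 2) * k3 + (r ^ 2 / 2 + r * g (P 3) 0) * h3
    have e5 : g (P 5) 1 = √3 * g (P 5) 0 := by
      apply mul_left_cancel₀ (mul_ne_zero h30 hr.ne')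
      linear_combination (-1 / 2) * k4 + (1 / 2) * k5 - (r ^ 2 / 2 + r * g (P 5) 0) * h3
    intro i
    fin_cases i
    · exact h0
    · refine Eq.trans ?_ (standardHexagon_one r p).symm
      ext j
      fin_cases j
      · simp [p]
        rfl
      · exact e1
      · rfl
    · exact h2
    · refine Eq.trans ?_ (standardHexagon_three r p).symm
      ext j
      fin_cases j
      · simp [p]
        rfl
      · refine e3.trans ?_
        simp [p]
        ring
      · rfl
    · exact h4
    · refine Eq.trans ?_ (standardHexagon_five r p).symm
      ext j
      fin_cases j
      · simp [p]
        rfl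
      · refine e5.trans ?_
        simp [p]
        ring
      · rfl
  refine ⟨p, isHexagon_standardHexagon.1 ?_, g, hg, hgp⟩
  intro i
  rw [← hgp, ← hgp, ← hgp, g.dist_map, g.dist_map]
  exact hP i

/-- The shape of a hexagon, in terms of invariants of orientation preserving isometries: `w` is
read off from the length of a long diagonal, as `|P₁P₄|² = (3r + w)² + v²` with
`w² + v² = 1 - 3 r²`, and `v` from the oriented volume of the tetrahedron with base `P₀P₂P₄`. -/
noncomputable def shape (r : ℝ) (P : ZMod 6 → E3) : Fin 3 → ℝ × ℝ :=
  ![((dist (P 1) (P 4) ^ 2 - 1 - 6 * r ^ 2) / (6 * r),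
      tripleProduct (P 2 - P 0) (P 4 - P 0) (P 1 - P 0) / (6 * √3 * r ^ 2)),
    ((dist (P 3) (P 0) ^ 2 - 1 - 6 * r ^ 2) / (6 * r),
      tripleProduct (P 2 - P 0) (P 4 - P 0) (P 3 - P 0) / (6 * √3 * r ^ 2)),
    ((dist (P 5) (P 2) ^ 2 - 1 - 6 * r ^ 2) / (6 * r),
      tripleProduct (P 2 - P 0) (P 4 - P 0) (P 5 - P 0) / (6 * √3 * r ^ 2))]

lemma shape_map (r : ℝ) {P Q : ZMod 6 → E3} {g : E3 ≃ᵃⁱ[ℝ] E3} (hg : g ∈ orientationPreserving)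
    (h : ∀ i, g (P i) = Q i) : shape r P = shape r Q := by
  simp only [shape, ← h, g.dist_map, tripleProduct_map hg]

lemma continuous_shape (r : ℝ) : Continuous (shape r) := by
  have ht : ∀ i, Continuous fun P : ZMod 6 → E3 =>
      tripleProduct (P 2 - P 0) (P 4 - P 0) (P i - P 0) := by
    intro i
    unfold tripleProduct
    simp only [PiLp.sub_apply]
    fun_prop
  refine continuous_pi fun i => ?_
  fin_cases i
  · exact Continuous.prodMk (by fun_prop) ((ht 1).div_const _)
  · exact Continuous.prodMk (by fun_prop) ((ht 3).div_const _)
  · exact Continuous.prodMk (by fun_prop) ((ht 5).div_const _)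

lemma shape_standardHexagon {r : ℝ} (hr : 0 < r) {p : Fin 3 → ℝ × ℝ} (hp : p ∈ shapeSpace r) :
    shape r (standardHexagon r p) = p := by
  obtain ⟨a, b, c, rfl⟩ : ∃ x y z, p = ![x, y, z] :=
    ⟨p 0, p 1, p 2, by ext i <;> fin_cases i <;> rfl⟩
  obtain ⟨⟨ha, hb, hc⟩, -⟩ := shapeSpace_mk.1 hp
  have h3 : √(3 : ℝ) ^ 2 = 3 := Real.sq_sqrt (by norm_num)
  have h30 : √(3 : ℝ) ≠ 0 := by positivity
  have hr0 := hr.ne'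
  have hd : 6 * √3 * r ^ 2 ≠ 0 := by positivity
  simp only [shape, standardHexagon_zero, standardHexagon_one,
    standardHexagon_two, standardHexagon_three, standardHexagon_four, standardHexagon_five,
    E3.dist_sq, tripleProduct, PiLp.sub_apply, Matrix.cons_val]
  funext i
  fin_cases i
  · refine Prod.ext ((div_eq_iff (by positivity)).2 ?_) ((div_eq_iff hd).2 ?_)
    · simp only [Fin.zero_eta, Matrix.cons_val]
      linear_combination ha
    · simp only [Fin.zero_eta, Matrix.cons_val]
      ring
  · refine Prod.ext ((div_eq_iff (by positivity)).2 ?_) ((div_eq_iff hd).2 ?_)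
    · simp only [Fin.mk_one, Matrix.cons_val]
      linear_combination hb + (r + (r + b.1) / 2) ^ 2 * h3
    · simp only [Fin.mk_one, Matrix.cons_val]
      ring
  · refine Prod.ext ((div_eq_iff (by positivity)).2 ?_) ((div_eq_iff hd).2 ?_)
    · simp only [Fin.reduceFinMk, Matrix.cons_val]
      linear_combination hc + (r + (r + c.1) / 2) ^ 2 * h3
    · simp only [Fin.reduceFinMk, Matrix.cons_val]
      ring

lemma continuous_standardHexagon (r : ℝ) : Continuous (standardHexagon r) := by
  refine continuous_pi fun i => ?_
  fin_cases i
  · exact continuous_const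
  · change Continuous fun p => standardHexagon r p 1
    simp only [standardHexagon_one]
    refine (PiLp.continuous_toLp _ _).comp (continuous_pi fun j => ?_)
    fin_cases j <;> simp <;> fun_prop
  · exact continuous_const
  · change Continuous fun p => standardHexagon r p 3
    simp only [standardHexagon_three]
    refine (PiLp.continuous_toLp _ _).comp (continuous_pi fun j => ?_)
    fin_cases j <;> simp <;> fun_prop
  · exact continuous_const
  · change Continuous fun p => standardHexagon r p 5
    simp only [standardHexagon_five]
    refine (PiLp.continuous_toLp _ _).comp (continuous_pi fun j => ?_)
    fin_cases j <;> simp <;> fun_prop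

/-- The configuration space is homeomorphic to the space of shapes; the inverse of `shape` is given
by the hexagons in normal position. -/
lemma exists_homeomorph_configSpace {θ r : ℝ} (h0 : 0 ≤ θ) (hπ : θ ≤ Real.pi) (hr0 : 0 < r)
    (hr : 12 * r ^ 2 = 2 - 2 * Real.cos θ) :
    ∃ Φ : ConfigSpace 6 θ ≃ₜ shapeSpace r,
      ∀ P : Polygons 6 θ, (Φ (ConfigSpace.mk P)).1 = shape r P.1 := by
  have hmem := mem_polygons_iff h0 hπ hr
  have hshape : ∀ P : Polygons 6 θ, shape r P.1 ∈ shapeSpace r := by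
    intro P
    obtain ⟨p, hp, g, hg, h⟩ := ((hmem P.1).1 P.2).exists_standardHexagon hr0
    rw [shape_map r hg h, shape_standardHexagon hr0 hp]
    exact hp
  let S : ConfigSpace 6 θ → shapeSpace r := Quotient.lift (fun P => ⟨shape r P.1, hshape P⟩)
    (by
      rintro P Q ⟨g, hg, h⟩
      exact Subtype.ext (shape_map r hg h))
  let T : shapeSpace r → Polygons 6 θ := fun p =>
    ⟨standardHexagon r p.1, (hmem _).2 (isHexagon_standardHexagon.2 p.2)⟩
  refine ⟨⟨⟨S, fun p => ConfigSpace.mk (T p), ?_, ?_⟩, ?_, ?_⟩, fun P => rfl⟩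
  · intro x
    induction x using Quotient.inductionOn with
    | h P =>
      obtain ⟨p, hp, g, hg, h⟩ := ((hmem P.1).1 P.2).exists_standardHexagon hr0
      refine Eq.symm (Quotient.sound ⟨g, hg, fun i => ?_⟩)
      rw [h i]
      change _ = standardHexagon r (shape r P.1) i
      rw [shape_map r hg h, shape_standardHexagon hr0 hp]
  · intro p
    exact Subtype.ext (shape_standardHexagon hr0 p.2)
  · exact Continuous.quotient_lift
      (((continuous_shape r).comp continuous_subtype_val).subtype_mk _) _
  · exact continuous_quotient_mk'.comp
      (((continuous_standardHexagon r).comp continuous_subtype_val).subtype_mk _)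

/-! ### Boats and chairs -/

/-- The compatibility relations then give the same value to all products `v_i v_j`. -/
lemma eq_const_of_fst_eq {r : ℝ} {p : Fin 3 → ℝ × ℝ} (hp : p ∈ shapeSpace r)
    (h1 : (p 1).1 = (p 0).1) (h2 : (p 2).1 = (p 0).1) : p = fun _ => p 0 := by
  have c0 := hp.1 0
  have c1 := hp.1 1
  have c2 := hp.1 2
  have c01 := hp.2 0 1 (by decide)
  have c02 := hp.2 0 2 (by decide)
  have c12 := hp.2 1 2 (by decide)
  rw [h1] at c01 c12 c1
  rw [h2] at c02 c12 c2
  have s1 : (p 0).2 * ((p 1).2 - (p 2).2) = 0 := by linear_combination (c02 - c01) / 2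
  have s2 : (p 1).2 * ((p 0).2 - (p 2).2) = 0 := by linear_combination (c12 - c01) / 2
  have e1 : (p 1).2 ^ 2 = (p 0).2 ^ 2 := by linear_combination c1 - c0
  have e2 : (p 2).2 ^ 2 = (p 0).2 ^ 2 := by linear_combination c2 - c0
  have h : (p 1).2 = (p 0).2 ∧ (p 2).2 = (p 0).2 := by
    rcases eq_or_ne (p 0).2 0 with h0 | h0
    · rw [h0] at e1 e2 ⊢
      exact ⟨pow_eq_zero_iff two_ne_zero |>.1 (by simpa using e1),
        pow_eq_zero_iff two_ne_zero |>.1 (by simpa using e2)⟩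
    · have h12 : (p 1).2 = (p 2).2 := sub_eq_zero.1 ((mul_eq_zero.1 s1).resolve_left h0)
      have h10 : (p 1).2 ≠ 0 := by
        intro h
        rw [h] at e1
        exact h0 (pow_eq_zero_iff two_ne_zero |>.1 (by linarith))
      have h02 : (p 0).2 = (p 2).2 := sub_eq_zero.1 ((mul_eq_zero.1 s2).resolve_left h10)
      exact ⟨h12.trans h02.symm, h02.symm⟩
  funext i
  fin_cases i
  · rfl
  · exact Prod.ext h1 h.1
  · exact Prod.ext h2 h.2

/-- A hexagon has a symmetric shape iff its three long diagonals have the same length. -/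
lemma shape_eq_const_iff {r : ℝ} (hr : 0 < r) {P : ZMod 6 → E3} (hP : shape r P ∈ shapeSpace r) :
    (∃ x, shape r P = fun _ => x) ↔
      ∀ i, dist (P i) (P (i + 3)) ^ 2 = dist (P (i + 1)) (P (i + 4)) ^ 2 := by
  have e : ∀ x y : ℝ, (x - 1 - 6 * r ^ 2) / (6 * r) = (y - 1 - 6 * r ^ 2) / (6 * r) ↔ x = y := by
    intro x y
    rw [div_left_inj' (by positivity), sub_left_inj, sub_left_inj]
  constructor
  · rintro ⟨x, hx⟩
    have h0 := congrArg Prod.fst (congrFun hx 0)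
    have h1 := congrArg Prod.fst (congrFun hx 1)
    have h2 := congrArg Prod.fst (congrFun hx 2)
    have h10 := (e _ _).1 (h1.trans h0.symm)
    have h20 := (e _ _).1 (h2.trans h0.symm)
    intro i
    fin_cases i
    · exact (dist_comm (P 0) (P 3)).symm ▸ h10
    · change dist (P 1) (P 4) ^ 2 = dist (P 2) (P 5) ^ 2
      rw [dist_comm (P 2), h20]
    · change dist (P 2) (P 5) ^ 2 = dist (P 3) (P 0) ^ 2
      rw [dist_comm (P 2), h20, h10]
    · change dist (P 3) (P 0) ^ 2 = dist (P 4) (P 1) ^ 2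
      rw [dist_comm (P 4), h10]
    · change dist (P 4) (P 1) ^ 2 = dist (P 5) (P 2) ^ 2
      rw [dist_comm (P 4), h20]
    · change dist (P 5) (P 2) ^ 2 = dist (P 0) (P 3) ^ 2
      rw [dist_comm (P 0), h20, h10]
  · intro h
    have h1 : dist (P 1) (P 4) ^ 2 = dist (P 2) (P 5) ^ 2 := h 1
    have h3 : dist (P 3) (P 0) ^ 2 = dist (P 4) (P 1) ^ 2 := h 3
    rw [dist_comm (P 2)] at h1
    rw [dist_comm (P 4)] at h3
    exact ⟨_, eq_const_of_fst_eq hP ((e _ _).2 h3) ((e _ _).2 h1.symm)⟩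

/-- The orthogonal complement of a plane in three-space is a line. -/
lemma eq_or_eq_neg_of_orthogonal {a b x y : E3} (ha : a ≠ 0) (hb : b ≠ 0)
    (hab : inner ℝ a b = 0) (hxa : inner ℝ x a = 0) (hxb : inner ℝ x b = 0)
    (hya : inner ℝ y a = 0) (hyb : inner ℝ y b = 0) (hxy : ‖x‖ = ‖y‖) : x = y ∨ x = -y := by
  obtain ⟨L, -, hLa, hLb⟩ := exists_rotation (e := ‖a‖⁻¹ • a) (f := ‖b‖⁻¹ • b)
    (norm_smul_inv_norm (𝕜 := ℝ) ha) (norm_smul_inv_norm (𝕜 := ℝ) hb)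
    (by rw [inner_smul_left, inner_smul_right, hab, mul_zero, mul_zero])
  have h0 : ∀ z, inner ℝ z a = 0 → L z 0 = 0 := by
    intro z hz
    have h := L.inner_map_map z (‖a‖⁻¹ • a)
    rw [hLa, inner_smul_right, hz, mul_zero] at h
    simpa [EuclideanSpace.inner_single_right] using h
  have h1 : ∀ z, inner ℝ z b = 0 → L z 1 = 0 := by
    intro z hz
    have h := L.inner_map_map z (‖b‖⁻¹ • b)
    rw [hLb, inner_smul_right, hz, mul_zero] at h
    simpa [EuclideanSpace.inner_single_right] using h
  have hn : dist (L x) 0 ^ 2 = dist (L y) 0 ^ 2 := by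
    rw [dist_zero_right, dist_zero_right, L.norm_map, L.norm_map, hxy]
  rw [E3.dist_sq, E3.dist_sq, h0 x hxa, h1 x hxb, h0 y hya, h1 y hyb] at hn
  have h2 : (L x 2) ^ 2 = (L y 2) ^ 2 := by simpa using hn
  rcases sq_eq_sq_iff_eq_or_eq_neg.1 h2 with h | h
  · left
    apply L.injective
    ext i
    fin_cases i
    · exact (h0 x hxa).trans (h0 y hya).symm
    · exact (h1 x hxb).trans (h1 y hyb).symm
    · exact h
  · right
    apply L.injective
    rw [map_neg]
    ext i
    fin_cases i
    · exact (h0 x hxa).trans (by simp [h0 y hya])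
    · exact (h1 x hxb).trans (by simp [h1 y hyb])
    · exact h

/-- The seat `A B C D` of a boat or chair with remaining vertices `X` and `Y` is a rectangle with
diagonals of squared length `1 + t`, where `t` is the squared length of the short diagonals of the
hexagon. The third long diagonal `X Y` has squared length `(1 - t)²` or `1 + t`, according to the
side of the plane of the rectangle on which `Y` lies. -/
lemma seat_dichotomy {A B C D X Y : E3} {t : ℝ} (ht : 0 < t) (hseat : D - A = C - B)
    (hAB : dist A B ^ 2 = t) (hAD : dist D A ^ 2 = 1)
    (hXA : dist X A ^ 2 = 1) (hXB : dist X B ^ 2 = 1) (hXC : dist X C ^ 2 = t)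
    (hXD : dist X D ^ 2 = t) (hYA : dist Y A ^ 2 = t) (hYB : dist Y B ^ 2 = t)
    (hYD : dist Y D ^ 2 = 1) :
    dist A C ^ 2 = 1 + t ∧ dist B D ^ 2 = 1 + t ∧
      (dist X Y ^ 2 = (1 - t) ^ 2 ∧ (affineSpan ℝ {D, A, B, C}).WSameSide X Y ∨
        dist X Y ^ 2 = 1 + t ∧ (affineSpan ℝ {D, A, B, C}).WOppSide X Y) := by
  obtain ⟨a, rfl⟩ : ∃ a, A = B + a := ⟨A - B, by abel⟩
  obtain ⟨b, rfl⟩ : ∃ b, C = B + b := ⟨C - B, by abel⟩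
  obtain rfl : D = B + a + b := by
    rw [sub_eq_iff_eq_add] at hseat
    rw [hseat]
    abel
  obtain ⟨x, rfl⟩ : ∃ x, X = B + a + x := ⟨X - (B + a), by abel⟩
  obtain ⟨y, rfl⟩ : ∃ y, Y = B + a + y := ⟨Y - (B + a), by abel⟩
  have n : ∀ u v : E3, dist u v ^ 2 = ‖u - v‖ ^ 2 := fun u v => by rw [dist_eq_norm]
  have haa : inner ℝ a a = t := by
    rw [real_inner_self_eq_norm_sq, ← hAB, n]
    congr 2
    abel
  have hbb : inner ℝ b b = (1 : ℝ) := by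
    rw [real_inner_self_eq_norm_sq, ← hAD, n]
    congr 2
    abel
  have hxx : inner ℝ x x = (1 : ℝ) := by
    rw [real_inner_self_eq_norm_sq, ← hXA, n]
    congr 2
    abel
  have hyy : inner ℝ y y = t := by
    rw [real_inner_self_eq_norm_sq, ← hYA, n]
    congr 2
    abel
  have hxa : inner ℝ x a = -t / 2 := by
    rw [n, show B + a + x - B = x + a by abel, norm_add_sq_real, ← real_inner_self_eq_norm_sq,
      ← real_inner_self_eq_norm_sq, hxx, haa] at hXB
    linarith
  have hya : inner ℝ y a = -t / 2 := by
    rw [n, show B + a + y - B = y + a by abel, norm_add_sq_real, ← real_inner_self_eq_norm_sq,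
      ← real_inner_self_eq_norm_sq, hyy, haa] at hYB
    linarith
  have hxb : inner ℝ x b = 1 - t / 2 := by
    rw [n, show B + a + x - (B + a + b) = x - b by abel, norm_sub_sq_real,
      ← real_inner_self_eq_norm_sq, ← real_inner_self_eq_norm_sq, hxx, hbb] at hXD
    linarith
  have hyb : inner ℝ y b = t / 2 := by
    rw [n, show B + a + y - (B + a + b) = y - b by abel, norm_sub_sq_real,
      ← real_inner_self_eq_norm_sq, ← real_inner_self_eq_norm_sq, hyy, hbb] at hYD
    linarith
  -- The parallelogram is a rectangle, since `X` is equidistant from the ends of both `t`-edges.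
  have hab : inner ℝ a b = (0 : ℝ) := by
    rw [n, show B + a + x - (B + b) = x + a - b by abel, norm_sub_sq_real, norm_add_sq_real,
      inner_add_left, ← real_inner_self_eq_norm_sq, ← real_inner_self_eq_norm_sq,
      ← real_inner_self_eq_norm_sq, hxx, haa, hbb, hxa, hxb] at hXC
    linarith
  have hba : inner ℝ b a = (0 : ℝ) := by rw [real_inner_comm, hab]
  -- The components of `X` and `Y` normal to the plane of the rectangle.
  obtain ⟨u, hu⟩ : ∃ u, u = x - ((-1 / 2 : ℝ) • a + (1 - t / 2) • b) := ⟨_, rfl⟩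
  obtain ⟨v, hv⟩ : ∃ v, v = y - ((-1 / 2 : ℝ) • a + (t / 2) • b) := ⟨_, rfl⟩
  have hua : inner ℝ u a = (0 : ℝ) := by
    rw [hu, inner_sub_left, inner_add_left, real_inner_smul_left, real_inner_smul_left,
      hxa, haa, hba]
    ring
  have hub : inner ℝ u b = (0 : ℝ) := by
    rw [hu, inner_sub_left, inner_add_left, real_inner_smul_left, real_inner_smul_left,
      hxb, hab, hbb]
    ring
  have hva : inner ℝ v a = (0 : ℝ) := by
    rw [hv, inner_sub_left, inner_add_left, real_inner_smul_left, real_inner_smul_left,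
      hya, haa, hba]
    ring
  have hvb : inner ℝ v b = (0 : ℝ) := by
    rw [hv, inner_sub_left, inner_add_left, real_inner_smul_left, real_inner_smul_left,
      hyb, hab, hbb]
    ring
  have hx : x = u + ((-1 / 2 : ℝ) • a + (1 - t / 2) • b) := by rw [hu]; abel
  have hy : y = v + ((-1 / 2 : ℝ) • a + (t / 2) • b) := by rw [hv]; abel
  have huu : inner ℝ u u = t * (3 - t) / 4 := by
    have h := hxx
    rw [hx] at h
    simp only [inner_add_left, inner_add_right, real_inner_smul_left, real_inner_smul_right, haa,
      hbb, hab, hba, hua, hub, real_inner_comm u a, real_inner_comm u b] at h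
    linarith
  have hvv : inner ℝ v v = t * (3 - t) / 4 := by
    have h := hyy
    rw [hy] at h
    simp only [inner_add_left, inner_add_right, real_inner_smul_left, real_inner_smul_right, haa,
      hbb, hab, hba, hva, hvb, real_inner_comm v a, real_inner_comm v b] at h
    linarith
  have ha0 : a ≠ 0 := by
    rintro rfl
    rw [inner_zero_left] at haa
    exact ht.ne haa
  have hb0 : b ≠ 0 := by
    rintro rfl
    rw [inner_zero_left] at hbb
    exact zero_ne_one hbb
  have hnorm : ‖u‖ = ‖v‖ := by
    rw [← sq_eq_sq₀ (norm_nonneg _) (norm_nonneg _), ← real_inner_self_eq_norm_sq,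
      ← real_inner_self_eq_norm_sq, huu, hvv]
  have hb1 : ‖b‖ ^ 2 = 1 := by rw [← real_inner_self_eq_norm_sq, hbb]
  have hu1 : ‖u‖ ^ 2 = t * (3 - t) / 4 := by rw [← real_inner_self_eq_norm_sq, huu]
  have hplane : ∀ s : ℝ, B + a + ((-1 / 2 : ℝ) • a + s • b) ∈
      affineSpan ℝ {B + a + b, B + a, B, B + b} := by
    intro s
    have m1 : B + a ∈ affineSpan ℝ {B + a + b, B + a, B, B + b} :=
      subset_affineSpan ℝ _ (by simp)
    have m2 : B ∈ affineSpan ℝ {B + a + b, B + a, B, B + b} :=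
      subset_affineSpan ℝ _ (by simp)
    have m3 : B + b ∈ affineSpan ℝ {B + a + b, B + a, B, B + b} :=
      subset_affineSpan ℝ _ (by simp)
    have d1 := AffineSubspace.vsub_mem_direction m1 m2
    have d2 := AffineSubspace.vsub_mem_direction m3 m2
    rw [vsub_eq_sub, add_sub_cancel_left] at d1 d2
    rw [add_comm (B + a) ((-1 / 2 : ℝ) • a + s • b)]
    exact AffineSubspace.vadd_mem_of_mem_direction
      (Submodule.add_mem _ (Submodule.smul_mem _ _ d1) (Submodule.smul_mem _ _ d2)) m1
  have exu : B + a + x - (B + a + ((-1 / 2 : ℝ) • a + (1 - t / 2) • b)) = u := by rw [hu]; abel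
  have eyv : B + a + y - (B + a + ((-1 / 2 : ℝ) • a + (t / 2) • b)) = v := by rw [hv]; abel
  refine ⟨?_, ?_, ?_⟩
  · rw [n, show B + a - (B + b) = a - b by abel, norm_sub_sq_real, ← real_inner_self_eq_norm_sq,
      ← real_inner_self_eq_norm_sq, haa, hbb, hab]
    ring
  · rw [n, norm_sub_rev, show B + a + b - B = a + b by abel, norm_add_sq_real,
      ← real_inner_self_eq_norm_sq, ← real_inner_self_eq_norm_sq, haa, hbb, hab]
    ring
  · rcases eq_or_eq_neg_of_orthogonal ha0 hb0 hab hua hub hva hvb hnorm with huv | huv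
    · left
      constructor
      · rw [n, show B + a + x - (B + a + y) = (1 - t) • b by rw [hx, hy, huv]; module,
          norm_smul, mul_pow, hb1, Real.norm_eq_abs, sq_abs, mul_one]
      · refine ⟨_, hplane (1 - t / 2), _, hplane (t / 2), ?_⟩
        rw [vsub_eq_sub, vsub_eq_sub, exu, eyv, huv]
        exact SameRay.refl v
    · right
      constructor
      · rw [n, show B + a + x - (B + a + y) = (1 - t) • b + (2 : ℝ) • u by
          rw [hx, hy, huv]; module, norm_add_sq_real, norm_smul, norm_smul, mul_pow, mul_pow,
          hb1, hu1, Real.norm_eq_abs, Real.norm_eq_abs, sq_abs, sq_abs, real_inner_smul_left, real_inner_smul_right,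
          real_inner_comm, hub]
        ring
      · refine ⟨_, hplane (1 - t / 2), _, hplane (t / 2), ?_⟩
        rw [vsub_eq_sub, vsub_eq_sub, exu, ← neg_sub, eyv, huv]
        exact SameRay.refl (-v)

lemma IsHexagon.seat_dichotomy {r : ℝ} (hr : 0 < r) {P : ZMod 6 → E3} (hP : IsHexagon r P)
    {i : ZMod 6} (hi : IsSeat P i) :
    dist (P (i - 1)) (P (i + 2)) ^ 2 = 1 + 12 * r ^ 2 ∧
      dist (P (i + 1)) (P (i - 2)) ^ 2 = 1 + 12 * r ^ 2 ∧
      (dist (P i) (P (i + 3)) ^ 2 = (1 - 12 * r ^ 2) ^ 2 ∧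
          (seatPlane P i).WSameSide (P i) (P (i + 3)) ∨
        dist (P i) (P (i + 3)) ^ 2 = 1 + 12 * r ^ 2 ∧
          (seatPlane P i).WOppSide (P i) (P (i + 3))) := by
  have h1 : ∀ j k, k = j + 1 → dist (P j) (P k) ^ 2 = 1 := by
    rintro j _ rfl
    exact (hP j).1
  have h2 : ∀ j k, k = j + 2 → dist (P j) (P k) ^ 2 = 12 * r ^ 2 := by
    rintro j _ rfl
    have := (hP (j + 1)).2
    rwa [add_sub_cancel_right, add_assoc, one_add_one_eq_two] at this
  have h1' : ∀ j k, j = k + 1 → dist (P j) (P k) ^ 2 = 1 := fun j k h =>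
    dist_comm (P k) (P j) ▸ h1 k j h
  have h2' : ∀ j k, j = k + 2 → dist (P j) (P k) ^ 2 = 12 * r ^ 2 := fun j k h =>
    dist_comm (P k) (P j) ▸ h2 k j h
  have six : (6 : ZMod 6) = 0 := rfl
  refine _root_.seat_dichotomy (by positivity) hi (h2 _ _ (by ring)) (h1 _ _ (by ring))
    (h1' _ _ (by ring)) (h1 _ _ (by ring)) (h2 _ _ (by ring)) (h2' _ _ (by ring))
    (h2 _ _ ?_) (h2' _ _ (by ring)) (h1 _ _ ?_)
  · linear_combination -six
  · linear_combination -six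

/-- In a boat, the long diagonals have squared lengths `1 + t`, `1 + t` and `(1 - t)²` with
`t = 12 r²`, and these differ unless `t = 0` or `t = 3`. -/
lemma IsHexagon.not_const_of_isBoat {r : ℝ} (hr : 0 < r) (hr' : 4 * r ^ 2 ≠ 1) {P : ZMod 6 → E3}
    (hP : IsHexagon r P) (hs : shape r P ∈ shapeSpace r) (hb : IsBoat P) :
    ¬ ∃ x, shape r P = fun _ => x := by
  obtain ⟨i, hi, hside⟩ := hb
  rw [shape_eq_const_iff hr hs]
  intro h
  obtain ⟨-, h1, ⟨h2, -⟩ | ⟨-, h2⟩⟩ := hP.seat_dichotomy hr hi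
  · have h3 := h i
    have six : (6 : ZMod 6) = 0 := rfl
    rw [h2, show i + 4 = i - 2 by linear_combination six, h1] at h3
    have : 36 * r ^ 2 * (4 * r ^ 2 - 1) ≠ 0 :=
      mul_ne_zero (by positivity) (sub_ne_zero.2 hr')
    exact this (by linear_combination h3)
  · exact hside.not_wOppSide h2

lemma IsHexagon.const_of_isChair {r : ℝ} (hr : 0 < r) {P : ZMod 6 → E3}
    (hP : IsHexagon r P) (hs : shape r P ∈ shapeSpace r) (hc : IsChair P) :
    ∃ x, shape r P = fun _ => x := by
  obtain ⟨i, hi, hside⟩ := hc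
  rw [shape_eq_const_iff hr hs]
  obtain ⟨h0, h1, ⟨-, h2⟩ | ⟨h2, -⟩⟩ := hP.seat_dichotomy hr hi
  · exact absurd h2 hside.not_wSameSide
  have six : (6 : ZMod 6) = 0 := rfl
  rw [show i - 2 = i + 4 by linear_combination -six] at h1
  rw [show i - 1 = i + 5 by linear_combination -six, dist_comm] at h0
  -- All three long diagonals have the same length.
  have key : ∀ j, dist (P (i + j)) (P (i + j + 3)) ^ 2 = 1 + 12 * r ^ 2 := by
    have ha : ∀ k l : ZMod 6, dist (P (i + k)) (P (i + l)) ^ 2 = 1 + 12 * r ^ 2 →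
        k + 3 = l → dist (P (i + k)) (P (i + k + 3)) ^ 2 = 1 + 12 * r ^ 2 := by
      rintro k l hkl rfl
      rwa [add_assoc]
    have hz : i + 0 = i := add_zero i
    intro j
    fin_cases j
    · exact ha 0 3 (by rwa [hz]) rfl
    · exact ha 1 4 h1 rfl
    · exact ha 2 5 h0 rfl
    · exact ha 3 0 (by rwa [hz, dist_comm]) rfl
    · exact ha 4 1 (by rwa [dist_comm]) rfl
    · exact ha 5 2 (by rwa [dist_comm]) rfl
  intro j
  have k1 := key (j - i)
  have k2 := key (j + 1 - i)
  rw [add_sub_cancel] at k1 k2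
  rw [k1, ← k2, add_assoc]
  rfl

/-! ### The folded hexagon -/

lemma exists_motion_edge {a b : E3} (hab : dist a b = 1) :
    ∃ g ∈ orientationPreserving, g a = 0 ∧ g b = EuclideanSpace.single 0 1 := by
  have hv : Orthonormal ℝ (({0} : Set (Fin 3)).domRestrict ![b - a, 0, 0]) := by
    constructor
    · rintro ⟨i, rfl⟩
      simpa [dist_eq_norm, norm_sub_rev] using hab
    · rintro ⟨i, rfl⟩ ⟨j, rfl⟩ hij
      exact absurd rfl hij
  obtain ⟨B, hB⟩ := hv.exists_orthonormalBasis_extension_of_card_eq (by simp)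
  have h0 : B 0 = b - a := hB 0 rfl
  obtain ⟨L, hL, hLe, -⟩ := exists_rotation (B.norm_eq_one 0) (B.norm_eq_one 1)
    (B.inner_eq_zero (by decide : (0 : Fin 3) ≠ 1))
  obtain ⟨g, hg, hgL⟩ := exists_orientationPreserving L hL a
  exact ⟨g, hg, by rw [hgL, sub_self, map_zero], by rw [hgL, ← h0, hLe]⟩

lemma configSpace_zero : Nonempty (ConfigSpace 6 0 ≃ₜ Unit) := by
  have hmem := mem_polygons_iff (r := 0) le_rfl Real.pi_pos.le (by simp)
  have hne : Nonempty (ConfigSpace 6 0) := by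
    let s : E3 := EuclideanSpace.single 0 1
    have h : dist (0 : E3) s ^ 2 = 1 := by simp [s]
    have h' : dist s 0 ^ 2 = 1 := by rw [dist_comm, h]
    refine ⟨ConfigSpace.mk ⟨![0, s, 0, s, 0, s], (hmem _).2 (isHexagon_iff.2 ?_)⟩⟩
    have hd : ∀ x : E3, dist x x ^ 2 = 12 * (0 : ℝ) ^ 2 := by simp
    exact ⟨⟨h, h', h, h', h, h'⟩, hd 0, hd 0, hd 0, hd s, hd s, hd s⟩
  have hsub : Subsingleton (ConfigSpace 6 0) := by
    -- Every such hexagon is carried to the one that traverses a fixed edge back and forth.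
    have key : ∀ P : Polygons 6 0, ∃ g ∈ orientationPreserving, ∀ i, g (P.1 i) =
        (![0, EuclideanSpace.single 0 1, 0, EuclideanSpace.single 0 1, 0,
          EuclideanSpace.single 0 1] : ZMod 6 → E3) i := by
      rintro ⟨P, hP⟩
      obtain ⟨⟨h01, -⟩, h02, -, h40, h13, -, h51⟩ := isHexagon_iff.1 ((hmem P).1 hP)
      have e : ∀ x y : E3, dist x y ^ 2 = 12 * (0 : ℝ) ^ 2 → x = y := by
        intro x y h
        exact dist_eq_zero.1 (pow_eq_zero_iff two_ne_zero |>.1 (by simpa using h))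
      obtain ⟨g, hg, h0, h1⟩ := exists_motion_edge
        ((pow_eq_one_iff_of_nonneg dist_nonneg two_ne_zero).1 h01)
      refine ⟨g, hg, fun i => ?_⟩
      fin_cases i
      · exact h0
      · exact h1
      · exact (congrArg g (e _ _ h02)).symm.trans h0
      · exact (congrArg g (e _ _ h13)).symm.trans h1
      · exact (congrArg g (e _ _ h40)).trans h0
      · exact (congrArg g (e _ _ h51)).trans h1
    refine ⟨fun x y => ?_⟩
    induction x using Quotient.inductionOn with
    | h P =>
      induction y using Quotient.inductionOn with
      | h Q =>
        obtain ⟨g, hg, h⟩ := key P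
        obtain ⟨k, hk, h'⟩ := key Q
        refine Quotient.sound ⟨k⁻¹ * g, orientationPreserving.mul_mem
          (orientationPreserving.inv_mem hk) hg, fun i => ?_⟩
        change k⁻¹ (g (P.1 i)) = Q.1 i
        rw [h i, ← h' i]
        exact k.symm_apply_apply _
  have : Unique (ConfigSpace 6 0) := uniqueOfSubsingleton hne.some
  exact ⟨Homeomorph.homeomorphOfUnique _ _⟩

/-! ### The configuration space of hexagons -/

lemma exists_inradius {θ : ℝ} (h0 : 0 < θ) (hπ : θ ≤ Real.pi) :
    ∃ r : ℝ, 0 < r ∧ 12 * r ^ 2 = 2 - 2 * Real.cos θ := by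
  have h : Real.cos θ < 1 := by
    rw [← Real.cos_zero]
    exact Real.cos_lt_cos_of_nonneg_of_le_pi le_rfl hπ h0
  refine ⟨√((1 - Real.cos θ) / 6), Real.sqrt_pos.2 (by linarith), ?_⟩
  rw [Real.sq_sqrt (by linarith)]
  ring

lemma cos_two_pi_div_three : Real.cos (2 * Real.pi / 3) = -1 / 2 := by
  rw [show 2 * Real.pi / 3 = Real.pi - Real.pi / 3 by ring, Real.cos_pi_sub, Real.cos_pi_div_three]
  norm_num

/-- A decomposition of the space of shapes in which the symmetric shapes are the isolated points
yields one of the configuration space that separates boats from chairs. -/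
lemma exists_homeomorph_configSpace_sum {θ r : ℝ} (h0 : 0 ≤ θ) (hπ : θ ≤ Real.pi) (hr0 : 0 < r)
    (hr : 12 * r ^ 2 = 2 - 2 * Real.cos θ) (hr' : 4 * r ^ 2 ≠ 1) {K : Type*} [TopologicalSpace K]
    {n : ℕ} (Ψ : shapeSpace r ≃ₜ K ⊕ Fin n)
    (hΨ : ∀ p, Ψ p ∈ Set.range Sum.inr ↔ ∃ x, p.1 = fun _ => x) :
    ∃ Φ : ConfigSpace 6 θ ≃ₜ K ⊕ Fin n,
      (∀ P : Polygons 6 θ, IsBoat P.1 → Φ (ConfigSpace.mk P) ∈ Set.range Sum.inl) ∧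
      (∀ P : Polygons 6 θ, IsChair P.1 → Φ (ConfigSpace.mk P) ∈ Set.range Sum.inr) := by
  obtain ⟨Φ, hΦ⟩ := exists_homeomorph_configSpace h0 hπ hr0 hr
  have hmem := mem_polygons_iff h0 hπ hr
  have hs : ∀ P : Polygons 6 θ, shape r P.1 ∈ shapeSpace r := fun P => hΦ P ▸ Subtype.coe_prop _
  refine ⟨Φ.trans Ψ, fun P hP => ?_, fun P hP => ?_⟩
  · by_contra h
    rw [← Set.mem_compl_iff, Set.compl_range_inl, Homeomorph.trans_apply, hΨ, hΦ] at h
    exact ((hmem P.1).1 P.2).not_const_of_isBoat hr0 hr' (hs P) hP h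
  · rw [Homeomorph.trans_apply, hΨ, hΦ]
    exact ((hmem P.1).1 P.2).const_of_isChair hr0 (hs P) hP

theorem mainTheorem2 (θ : ℝ) (hθ : θ ≠ Real.pi / 3) :
    (θ = 0 ∨ θ = 2 * Real.pi / 3 → Nonempty (ConfigSpace 6 θ ≃ₜ Unit)) ∧
    (Real.pi / 3 < θ → θ < 2 * Real.pi / 3 →
      ∃ Φ : ConfigSpace 6 θ ≃ₜ Circle ⊕ Fin 2,
        (∀ P : Polygons 6 θ, IsBoat P.1 → Φ (ConfigSpace.mk P) ∈ Set.range Sum.inl) ∧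
        (∀ P : Polygons 6 θ, IsChair P.1 → Φ (ConfigSpace.mk P) ∈ Set.range Sum.inr)) ∧
    (0 < θ → θ < Real.pi / 3 →
      ∃ Φ : ConfigSpace 6 θ ≃ₜ (Circle ⊕ Circle) ⊕ Fin 4,
        (∀ P : Polygons 6 θ, IsBoat P.1 → Φ (ConfigSpace.mk P) ∈ Set.range Sum.inl) ∧
        (∀ P : Polygons 6 θ, IsChair P.1 → Φ (ConfigSpace.mk P) ∈ Set.range Sum.inr)) ∧
    (θ < 0 ∨ 2 * Real.pi / 3 < θ → IsEmpty (ConfigSpace 6 θ)) := by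
  have hpi := Real.pi_pos
  refine ⟨?_, ?_, ?_, ?_⟩
  · rintro (rfl | rfl)
    · exact configSpace_zero
    · -- The short diagonals have length `√3`, so that `r = 1 / 2`.
      obtain ⟨Φ, -⟩ := exists_homeomorph_configSpace (θ := 2 * Real.pi / 3)
        (r := 1 / 2) (by positivity) (by linarith)
        (by norm_num) (by rw [cos_two_pi_div_three]; norm_num)
      have hu : Unique (shapeSpace (1 / 2)) := by
        rw [shapeSpace_half]
        infer_instance
      exact ⟨Φ.trans (Homeomorph.homeomorphOfUnique _ _)⟩
  · intro h1 h2
    obtain ⟨r, hr0, hr⟩ := exists_inradius (θ := θ) (by linarith) (by linarith)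
    have c1 := Real.cos_lt_cos_of_nonneg_of_le_pi (by positivity) (by linarith) h1
    have c2 := Real.cos_lt_cos_of_nonneg_of_le_pi (by linarith) (by linarith) h2
    rw [Real.cos_pi_div_three] at c1
    rw [cos_two_pi_div_three] at c2
    obtain ⟨Ψ, hΨ⟩ := shapeSpace_homeomorph_circle hr0 (by linarith) (by linarith)
    exact exists_homeomorph_configSpace_sum (by linarith) (by linarith) hr0 hr (by linarith) Ψ hΨ
  · intro h1 h2
    obtain ⟨r, hr0, hr⟩ := exists_inradius (θ := θ) (by linarith) (by linarith)
    have c1 := Real.cos_lt_cos_of_nonneg_of_le_pi h1.le (by linarith) h2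
    rw [Real.cos_pi_div_three] at c1
    obtain ⟨Ψ, hΨ⟩ := shapeSpace_homeomorph_two_circles hr0 (by linarith)
    exact exists_homeomorph_configSpace_sum (by linarith) (by linarith) hr0 hr (by linarith) Ψ hΨ
  · intro h
    -- Outside `[0, π]` the value `θ` is not an angle at all.
    by_cases hπ : 2 * Real.pi / 3 < θ ∧ θ ≤ Real.pi
    · obtain ⟨r, hr0, hr⟩ := exists_inradius (θ := θ) (by linarith) hπ.2
      have c2 := Real.cos_lt_cos_of_nonneg_of_le_pi (by positivity) hπ.2 hπ.1
      rw [cos_two_pi_div_three] at c2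
      obtain ⟨Φ, -⟩ := exists_homeomorph_configSpace (by linarith) hπ.2 hr0 hr
      refine ⟨fun x => ?_⟩
      exact Set.eq_empty_iff_forall_notMem.1 (shapeSpace_eq_empty hr0 (by linarith)) _ (Φ x).2
    · refine ⟨fun x => ?_⟩
      induction x using Quotient.inductionOn with
      | h P =>
        have h1 := (P.2 0).2
        have h2 := EuclideanGeometry.angle_nonneg (P.1 (0 - 1)) (P.1 0) (P.1 (0 + 1))
        have h3 := EuclideanGeometry.angle_le_pi (P.1 (0 - 1)) (P.1 0) (P.1 (0 + 1))
        rw [h1] at h2 h3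
        rcases h with h | h
        · linarith
        · exact hπ ⟨h, h3⟩
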